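/- Let $d\in\{2,3\}$, $k\ge 1$, and let $\Omega\subset\mathbb R^d$ be a bounded connected polygonal (polyhedral) domain. Let $\Omega_1,\Omega_2\subset\Omega$ be disjoint open sets with $\Omega\subset\Omega_1\cup\Omega_2\cup\Gamma$, where $\Gamma:=\overline\Omega_1\cap\overline\Omega_2$ is the interface. Regularity of $\Gamma$, with constants $K,r>0$: for every $x\in\Gamma$ there is a parametrization $\psi$ of a part of $\Gamma$, defined on $H\cap B(y_0,r)$ with $H=\{y\in\mathbb R^{d-1}: y_1\ge 0\}$, $y_0\in H$, $\psi(y_0)=x$, such that $\psi$ and $\psi^{-1}$ are Lipschitz with constant $K$ and the image of $\psi$ is contained in $\Gamma$ and contains $\Gamma\cap B(x,r/K)$. (Every compact embedded $C^1$ hypersurface, with or without boundary, has this property for some $K,r$.) Let $\mathcal T_h$ be a conforming simplicial triangulation of $\Omega$ that is shape regular with constant $\sigma>0$ (each simplex $T$ contains a ball of radius $h_T/\sigma$, where $h_T=\operatorname{diam}T$), and assume that no Lagrange node of degree $k$ lies on $\Gamma$. Let $\mathcal T_h^\Gamma$ be the set of the closed simplices $T\in\mathcal T_h$ that are cut by $\Gamma$,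 i.e. that intersect both $\Omega_1$ and $\Omega_2$, let $\Omega_h^\Gamma=\bigcup_{T\in\mathcal T_h^\Gamma}T$, and let $\Omega_{i,h}^{ex}$ be the union of the simplices that intersect $\Omega_i$. Let $V_h$ be the space of continuous piecewise polynomials of degree at most $k$ that vanish on $\partial\Omega$, with nodal basis functions $\phi_j$, $j\in I_0$; let $I^\Gamma\subset I_0$ be the set of the nodes in $\Omega_h^\Gamma$, $I_i^\Gamma$ the set of those nodes in $I^\Gamma$ that are not in $\Omega_i$, $\phi_j^\Gamma:=\phi_j|_{\Omega_h^\Gamma}$ (extended by zero), $V^\Gamma:=\operatorname{span}\{\phi_j^\Gamma: j\in I^\Gamma\}$, and $$Q_i\Big(\sum_{j\in I^\Gamma}\beta_j\phi_j^\Gamma\Big):=\sum_{j\in I_i^\Gamma}\beta_j\phi_j^\Gamma,\qquad i=1,2.$$ For $(u_0,u^\Gamma)\in V_h\times V^\Gamma$ put $$\|(u_0,u^\Gamma)\|_b^2:=\sum_{i=1}^2\|\nabla(u_0+Q_iu^\Gamma)\|_{L^2(\Omega_{i,h}^{ex})}^2+\sum_{T\in\mathcal T_h^\Gamma}h_T^{-1}\|Q_1u^\Gamma-Q_2u^\Gamma\|_{L^2(T\cap\Gamma)}^2,$$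 $$\|h^{-1}u^\Gamma\|_{\Omega_h^\Gamma}^2:=\sum_{T\in\mathcal T_h^\Gamma}h_T^{-2}\|u^\Gamma\|_{L^2(T)}^2.$$ Then there are constants $c,C>0$ that depend only on $d,k,\Omega,\sigma,K,r$ (in particular neither on the mesh size nor on the location of $\Gamma$ in the triangulation) such that, for all such $\Omega_1,\Omega_2$ and all such $\mathcal T_h$, $$c\,\|h^{-1}u^\Gamma\|_{\Omega_h^\Gamma}\le\|(0,u^\Gamma)\|_b\le C\,\|h^{-1}u^\Gamma\|_{\Omega_h^\Gamma}\qquad\text{for all }u^\Gamma\in V^\Gamma.$$ -/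

import Mathlib

open MeasureTheory

noncomputable section

namespace CutFEM

/-- The ambient space `ℝᵈ` with its Euclidean norm. -/
abbrev Space (d : ℕ) : Type := EuclideanSpace ℝ (Fin d)

variable {d : ℕ}

/-! ### Domain, subdomains, interface -/

/-- A bounded connected domain that is the interior of its closure. (That `Ω` is polygonal, or
polyhedral, is expressed by the existence of a simplicial triangulation, see `IsTriangulation`.) -/
structure IsBoundedDomain (Ω : Set (Space d)) : Prop where
  isConnected : IsConnected Ω
  isBounded : Bornology.IsBounded Ω
  interior_closure : interior (closure Ω) = Ω

/-- The interface `Γ = closure Ω₁ ∩ closure Ω₂`. -/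
def interface (Ωs : Fin 2 → Set (Space d)) : Set (Space d) :=
  closure (Ωs 0) ∩ closure (Ωs 1)

/-- `Ω₁, Ω₂` is a non-overlapping partitioning of `Ω`, up to the interface. -/
structure IsPartition (Ω : Set (Space d)) (Ωs : Fin 2 → Set (Space d)) : Prop where
  isOpen : ∀ i, IsOpen (Ωs i)
  subset : ∀ i, Ωs i ⊆ Ω
  disjoint : Disjoint (Ωs 0) (Ωs 1)
  cover : Ω ⊆ Ωs 0 ∪ Ωs 1 ∪ interface Ωs

/-- The closed half space `{y | 0 ≤ y₁}` of the parameter space `ℝᵈ⁻¹`. -/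
def halfSpace (d : ℕ) : Set (Space (d - 1)) := {y | ∀ i : Fin (d - 1), i.val = 0 → 0 ≤ y i}

/-- `Γ` is a hypersurface, possibly with boundary, of Lipschitz regularity with constants `K, r`:
around each `x ∈ Γ` there is a `K`-bi-Lipschitz parametrization of a part of `Γ`, defined on a
(half) ball of radius `r`, which covers `Γ ∩ ball x (r / K)`. Every compact embedded `C¹`
hypersurface (with or without boundary) has this property for some `K, r`. -/
def IsRegularHypersurface (K r : ℝ) (Γ : Set (Space d)) : Prop :=
  ∀ x ∈ Γ, ∃ (ψ : Space (d - 1) → Space d) (y₀ : Space (d - 1)),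
    y₀ ∈ halfSpace d ∧ ψ y₀ = x ∧
    (∀ y ∈ halfSpace d ∩ Metric.ball y₀ r, ∀ z ∈ halfSpace d ∩ Metric.ball y₀ r,
      dist (ψ y) (ψ z) ≤ K * dist y z ∧ dist y z ≤ K * dist (ψ y) (ψ z)) ∧
    ψ '' (halfSpace d ∩ Metric.ball y₀ r) ⊆ Γ ∧
    Γ ∩ Metric.ball x (r / K) ⊆ ψ '' (halfSpace d ∩ Metric.ball y₀ r)

/-! ### Triangulations -/

/-- The (closed) simplex with vertex set `t`. -/
def simplex (t : Finset (Space d)) : Set (Space d) := convexHull ℝ (t : Set (Space d))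

/-- The local mesh size `h_T`. -/
def meshSize (t : Finset (Space d)) : ℝ := Metric.diam (simplex t)

/-- The vertex sets of the `d`-dimensional simplices of a simplicial complex. -/
def cells (𝒯 : Geometry.SimplicialComplex ℝ (Space d)) : Set (Finset (Space d)) :=
  {t | t ∈ 𝒯.faces ∧ t.card = d + 1}

/-- `𝒯` is a (conforming) simplicial triangulation of `Ω`. -/
structure IsTriangulation (𝒯 : Geometry.SimplicialComplex ℝ (Space d)) (Ω : Set (Space d)) :
    Prop where
  finite : 𝒯.faces.Finite
  pure : ∀ s ∈ 𝒯.faces, ∃ t ∈ cells 𝒯, s ⊆ t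
  space_eq : 𝒯.space = closure Ω

/-- Shape regularity with constant `σ`: every simplex `T` contains a ball of radius `h_T / σ`. -/
def IsShapeRegular (σ : ℝ) (𝒯 : Geometry.SimplicialComplex ℝ (Space d)) : Prop :=
  ∀ t ∈ cells 𝒯, ∃ z, Metric.closedBall z (meshSize t / σ) ⊆ simplex t

/-- The set `𝒯_h^Γ` of the simplices cut by the interface: those that meet both subdomains. -/
def cutCells (𝒯 : Geometry.SimplicialComplex ℝ (Space d)) (Ωs : Fin 2 → Set (Space d)) :
    Set (Finset (Space d)) :=
  {t | t ∈ cells 𝒯 ∧ ∀ i, (simplex t ∩ Ωs i).Nonempty}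

/-- The domain `Ω_h^Γ` formed by the cut simplices. -/
def cutDomain (𝒯 : Geometry.SimplicialComplex ℝ (Space d)) (Ωs : Fin 2 → Set (Space d)) :
    Set (Space d) :=
  ⋃ t ∈ cutCells 𝒯 Ωs, simplex t

/-- The extended subdomain `Ω_{i,h}^ex` formed by the simplices that meet `Ω_i`. -/
def extDomain (𝒯 : Geometry.SimplicialComplex ℝ (Space d)) (Ωs : Fin 2 → Set (Space d))
    (i : Fin 2) : Set (Space d) :=
  ⋃ t ∈ {t | t ∈ cells 𝒯 ∧ (simplex t ∩ Ωs i).Nonempty}, simplex t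

/-! ### Lagrange finite elements -/

/-- `w` is a system of barycentric coordinates of `y` with respect to a face of `𝒯`. -/
def IsBarycentric (𝒯 : Geometry.SimplicialComplex ℝ (Space d)) (y : Space d)
    (w : Space d → ℝ) : Prop :=
  ∃ s ∈ 𝒯.faces, (∀ v ∉ s, w v = 0) ∧ (∀ v ∈ s, 0 ≤ w v) ∧ ∑ v ∈ s, w v = 1 ∧
    ∑ v ∈ s, w v • v = y

open Classical in
/-- `baryCoord 𝒯 v y` is the barycentric coordinate of `y` with respect to the vertex `v`; as a
function of `y` it is the piecewise linear hat function of `v`, extended by zero outside `𝒯`. -/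
def baryCoord (𝒯 : Geometry.SimplicialComplex ℝ (Space d)) (v y : Space d) : ℝ :=
  if h : ∃ w, IsBarycentric 𝒯 y w then h.choose v else 0

/-- The nodes of the Lagrange element of degree `k` are labelled by multi-indices `a` of order `k`
that are supported on the vertices of a common simplex. -/
def IsNode (𝒯 : Geometry.SimplicialComplex ℝ (Space d)) (k : ℕ) (a : Space d →₀ ℕ) : Prop :=
  a.support ∈ 𝒯.faces ∧ ∑ v ∈ a.support, a v = k

/-- The position `∑ v, (a v / k) v` of the node with label `a`. -/
def nodePos (k : ℕ) (a : Space d →₀ ℕ) : Space d :=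
  ∑ v ∈ a.support, ((a v : ℝ) / k) • v

/-- The nodal basis function `φ_a` of degree `k`, by the Lagrange formula in barycentric
coordinates. -/
def nodalBasis (𝒯 : Geometry.SimplicialComplex ℝ (Space d)) (k : ℕ) (a : Space d →₀ ℕ)
    (y : Space d) : ℝ :=
  ∏ v ∈ a.support, ∏ m ∈ Finset.range (a v), (k * baryCoord 𝒯 v y - m) / ((a v : ℝ) - m)

/-- The labels `I₀` of the finite element nodes of `V_h`: those in `Ω`, since the functions in
`V_h` vanish on `∂Ω`. -/
def nodes (𝒯 : Geometry.SimplicialComplex ℝ (Space d)) (k : ℕ) (Ω : Set (Space d)) :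
    Set (Space d →₀ ℕ) :=
  {a | IsNode 𝒯 k a ∧ nodePos k a ∈ Ω}

/-- The labels `I^Γ` of the finite element nodes in `Ω_h^Γ`. -/
def cutNodes (𝒯 : Geometry.SimplicialComplex ℝ (Space d)) (k : ℕ) (Ω : Set (Space d))
    (Ωs : Fin 2 → Set (Space d)) : Set (Space d →₀ ℕ) :=
  {a | a ∈ nodes 𝒯 k Ω ∧ nodePos k a ∈ cutDomain 𝒯 Ωs}

/-- The labels `I_i^Γ` of the finite element nodes in `Ω_h^Γ` that are not in `Ω_i`. -/
def cutNodesOf (𝒯 : Geometry.SimplicialComplex ℝ (Space d)) (k : ℕ) (Ω : Set (Space d))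
    (Ωs : Fin 2 → Set (Space d)) (i : Fin 2) : Set (Space d →₀ ℕ) :=
  {a | a ∈ cutNodes 𝒯 k Ω Ωs ∧ nodePos k a ∉ Ωs i}

/-- The cut basis function `φ_a^Γ`: the restriction of `φ_a` to `Ω_h^Γ`, extended by zero. -/
def cutBasis (𝒯 : Geometry.SimplicialComplex ℝ (Space d)) (k : ℕ) (Ωs : Fin 2 → Set (Space d))
    (a : Space d →₀ ℕ) : Space d → ℝ :=
  (cutDomain 𝒯 Ωs).indicator (nodalBasis 𝒯 k a)

/-- The global finite element space `V_h = span {φ_j | j ∈ I₀}`. -/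
def globalSpace (𝒯 : Geometry.SimplicialComplex ℝ (Space d)) (k : ℕ) (Ω : Set (Space d)) :
    Submodule ℝ (Space d → ℝ) :=
  Submodule.span ℝ (nodalBasis 𝒯 k '' nodes 𝒯 k Ω)

/-- The local cut space `V^Γ = span {φ_j^Γ | j ∈ I^Γ}`. -/
def cutSpace (𝒯 : Geometry.SimplicialComplex ℝ (Space d)) (k : ℕ) (Ω : Set (Space d))
    (Ωs : Fin 2 → Set (Space d)) : Submodule ℝ (Space d → ℝ) :=
  Submodule.span ℝ (cutBasis 𝒯 k Ωs '' cutNodes 𝒯 k Ω Ωs)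

/-- The projection `Q_i : V^Γ → V_i^Γ`, `∑_{j ∈ I^Γ} β_j φ_j^Γ ↦ ∑_{j ∈ I_i^Γ} β_j φ_j^Γ`. The
coefficient `β_j` of `u` is its value at the node `j`; see `cutProj_sum` below. -/
def cutProj (𝒯 : Geometry.SimplicialComplex ℝ (Space d)) (k : ℕ) (Ω : Set (Space d))
    (Ωs : Fin 2 → Set (Space d)) (i : Fin 2) (u : Space d → ℝ) : Space d → ℝ :=
  ∑ᶠ a ∈ cutNodesOf 𝒯 k Ω Ωs i, u (nodePos k a) • cutBasis 𝒯 k Ωs a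

/-! ### Norms -/

/-- The component `u_{i,h} = u₀ + Q_i u^Γ` of `L (u₀, u^Γ)`, to be considered on `Ω_{i,h}^ex`. -/
def component (𝒯 : Geometry.SimplicialComplex ℝ (Space d)) (k : ℕ) (Ω : Set (Space d))
    (Ωs : Fin 2 → Set (Space d)) (u : globalSpace 𝒯 k Ω × cutSpace 𝒯 k Ω Ωs) (i : Fin 2) :
    Space d → ℝ :=
  (u.1 : Space d → ℝ) + cutProj 𝒯 k Ω Ωs i (u.2 : Space d → ℝ)

/-- The squared scaled interface norm
`‖h^{-1/2} v‖_Γ² = ∑_{T ∈ 𝒯_h^Γ} h_T^{-1} ‖v‖²_{T ∩ Γ}`, with the surface measure on `Γ`. -/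
def interfaceNormSq (𝒯 : Geometry.SimplicialComplex ℝ (Space d)) (Ωs : Fin 2 → Set (Space d))
    (v : Space d → ℝ) : ℝ :=
  ∑ᶠ t ∈ cutCells 𝒯 Ωs,
    (meshSize t)⁻¹ * ∫ x in simplex t ∩ interface Ωs, v x ^ 2 ∂(μHE[d - 1])

/-- The norm `‖(u₀, u^Γ)‖_b`, given by
`‖(u₀, u^Γ)‖_b² = ∑_i ‖∇ u_{i,h}‖²_{Ω_{i,h}^ex} + ‖h^{-1/2} (u_{1,h} - u_{2,h})‖_Γ²`. The gradient
of a piecewise polynomial is taken pointwise in the interior of the simplices. -/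
def bNorm (𝒯 : Geometry.SimplicialComplex ℝ (Space d)) (k : ℕ) (Ω : Set (Space d))
    (Ωs : Fin 2 → Set (Space d)) (u : globalSpace 𝒯 k Ω × cutSpace 𝒯 k Ω Ωs) : ℝ :=
  Real.sqrt
    (∑ i : Fin 2, (∫ x in extDomain 𝒯 Ωs i, ‖gradient (component 𝒯 k Ω Ωs u i) x‖ ^ 2) +
      interfaceNormSq 𝒯 Ωs (component 𝒯 k Ω Ωs u 0 - component 𝒯 k Ω Ωs u 1))

/-- The scaled `L²` norm `‖h^{-1} v‖_{Ω_h^Γ} = (∑_{T ∈ 𝒯_h^Γ} h_T^{-2} ‖v‖_T²)^{1/2}`. -/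
def scaledL2Norm (𝒯 : Geometry.SimplicialComplex ℝ (Space d)) (Ωs : Fin 2 → Set (Space d))
    (v : Space d → ℝ) : ℝ :=
  Real.sqrt (∑ᶠ t ∈ cutCells 𝒯 Ωs, (meshSize t ^ 2)⁻¹ * ∫ x in simplex t, v x ^ 2)

/-! ### The projections `Q_i` act on the coefficients -/

open Classical in
theorem IsBarycentric.unique {𝒯 : Geometry.SimplicialComplex ℝ (Space d)} {y : Space d}
    {w w' : Space d → ℝ} (h : IsBarycentric 𝒯 y w) (h' : IsBarycentric 𝒯 y w') : w = w' := by
  have key : ∀ s ∈ 𝒯.faces, ∀ p q : Space d → ℝ, (∀ v ∉ s, p v = 0) → (∀ v ∉ s, q v = 0) →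
      ∑ v ∈ s, p v = 1 → ∑ v ∈ s, q v = 1 → ∑ v ∈ s, p v • v = ∑ v ∈ s, q v • v → p = q := by
    intro s hs p q hp hq hp1 hq1 hpq
    have hi := (affineIndependent_iff.1 (𝒯.indep hs)) Finset.univ (fun v => p v - q v)
      (by
        rw [Finset.sum_sub_distrib, Finset.sum_coe_sort s p, Finset.sum_coe_sort s q, hp1, hq1,
          sub_self])
      (by
        simp only [sub_smul]
        rw [Finset.sum_sub_distrib, Finset.sum_coe_sort s (fun v => p v • v),
          Finset.sum_coe_sort s (fun v => q v • v), hpq, sub_self])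
    funext v
    by_cases hv : v ∈ s
    · exact sub_eq_zero.1 (hi ⟨v, hv⟩ (Finset.mem_univ _))
    · rw [hp v hv, hq v hv]
  obtain ⟨s, hs, h0, hn, h1, hy⟩ := h
  obtain ⟨t, ht, h0', hn', h1', hy'⟩ := h'
  have hys : y ∈ convexHull ℝ (s : Set (Space d)) :=
    Finset.mem_convexHull'.2 ⟨w, hn, h1, hy⟩
  have hyt : y ∈ convexHull ℝ (t : Set (Space d)) :=
    Finset.mem_convexHull'.2 ⟨w', hn', h1', hy'⟩
  have hyst := 𝒯.inter_subset_convexHull hs ht ⟨hys, hyt⟩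
  rw [← Finset.coe_inter] at hyst
  obtain ⟨p, -, hp1, hpy⟩ := Finset.mem_convexHull'.1 hyst
  let q : Space d → ℝ := fun v => if v ∈ s ∩ t then p v else 0
  have hq0 : ∀ v ∉ s ∩ t, q v = 0 := fun v hv => if_neg hv
  have hqe : ∀ v ∈ s ∩ t, q v = p v := fun v hv => if_pos hv
  have ext : ∀ u : Finset (Space d), s ∩ t ⊆ u →
      ∑ v ∈ u, q v = 1 ∧ ∑ v ∈ u, q v • v = y := by
    intro u hu
    constructor
    · rw [← Finset.sum_subset hu (fun v _ hv => hq0 v hv), Finset.sum_congr rfl hqe, hp1]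
    · rw [← Finset.sum_subset hu (fun v _ hv => by rw [hq0 v hv, zero_smul]),
        Finset.sum_congr rfl (fun v hv => by rw [hqe v hv]), hpy]
  have es := ext s Finset.inter_subset_left
  have et := ext t Finset.inter_subset_right
  have e1 : w = q := key s hs w q h0
    (fun v hv => hq0 v (fun hh => hv (Finset.mem_inter.1 hh).1)) h1 es.1 (by rw [hy, es.2])
  have e2 : w' = q := key t ht w' q h0'
    (fun v hv => hq0 v (fun hh => hv (Finset.mem_inter.1 hh).2)) h1' et.1 (by rw [hy', et.2])
  rw [e1, e2]

theorem IsBarycentric.baryCoord_eq {𝒯 : Geometry.SimplicialComplex ℝ (Space d)} {y : Space d}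
    {w : Space d → ℝ} (h : IsBarycentric 𝒯 y w) (v : Space d) : baryCoord 𝒯 v y = w v := by
  have he : ∃ w, IsBarycentric 𝒯 y w := ⟨w, h⟩
  unfold baryCoord
  rw [dif_pos he, he.choose_spec.unique h]

theorem baryCoord_nodePos {𝒯 : Geometry.SimplicialComplex ℝ (Space d)} {k : ℕ} (hk : 1 ≤ k)
    {a : Space d →₀ ℕ} (ha : IsNode 𝒯 k a) (v : Space d) :
    baryCoord 𝒯 v (nodePos k a) = (a v : ℝ) / k := by
  have hk' : (k : ℝ) ≠ 0 := by positivity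
  refine IsBarycentric.baryCoord_eq (w := fun v => (a v : ℝ) / k)
    ⟨a.support, ha.1, ?_, fun v _ => by positivity, ?_, rfl⟩ v
  · intro v hv
    simp [Finsupp.notMem_support_iff.1 hv]
  · rw [← Finset.sum_div, ← Nat.cast_sum, ha.2, div_self hk']

open Classical in
/-- The nodal property `φ_a (x_b) = δ_{ab}`. -/
theorem nodalBasis_nodePos {𝒯 : Geometry.SimplicialComplex ℝ (Space d)} {k : ℕ} (hk : 1 ≤ k)
    {a b : Space d →₀ ℕ} (ha : IsNode 𝒯 k a) (hb : IsNode 𝒯 k b) :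
    nodalBasis 𝒯 k a (nodePos k b) = if a = b then 1 else 0 := by
  have hk' : (k : ℝ) ≠ 0 := by positivity
  have hval : ∀ v, (k : ℝ) * baryCoord 𝒯 v (nodePos k b) = b v := by
    intro v
    rw [baryCoord_nodePos hk hb, mul_div_cancel₀ _ hk']
  unfold nodalBasis
  simp only [hval]
  split_ifs with hab
  · subst hab
    refine Finset.prod_eq_one fun v _ => Finset.prod_eq_one fun m hm => div_self ?_
    have : (m : ℝ) < a v := by exact_mod_cast Finset.mem_range.1 hm
    exact (sub_pos.2 this).ne'
  · have hex : ∃ v ∈ a.support, b v < a v := by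
      by_contra! hcon
      apply hab
      have hle : ∀ v, a v ≤ b v := by
        intro v
        by_cases hv : v ∈ a.support
        · exact hcon v hv
        · rw [Finsupp.notMem_support_iff.1 hv]; exact Nat.zero_le _
      have hsub : a.support ⊆ b.support := by
        intro v hv
        rw [Finsupp.mem_support_iff] at hv ⊢
        have := hle v
        omega
      have hs : ∑ v ∈ b.support, a v = ∑ v ∈ b.support, b v := by
        rw [hb.2, ← ha.2]
        exact (Finset.sum_subset hsub
          (fun v _ hv => Finsupp.notMem_support_iff.1 hv)).symm
      have heq := (Finset.sum_eq_sum_iff_of_le (fun v _ => hle v)).1 hs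
      ext v
      by_cases hv : v ∈ b.support
      · exact heq v hv
      · have h1 := Finsupp.notMem_support_iff.1 hv
        have h2 := hle v
        omega
    obtain ⟨v, hv, hlt⟩ := hex
    refine Finset.prod_eq_zero hv (Finset.prod_eq_zero (Finset.mem_range.2 hlt) ?_)
    simp

open Classical in
/-- `Q_i (∑_{j ∈ I^Γ} β_j φ_j^Γ) = ∑_{j ∈ I_i^Γ} β_j φ_j^Γ`. -/
theorem cutProj_sum {𝒯 : Geometry.SimplicialComplex ℝ (Space d)} {k : ℕ} (hk : 1 ≤ k)
    {Ω : Set (Space d)} {Ωs : Fin 2 → Set (Space d)} (i : Fin 2) (s : Finset (Space d →₀ ℕ))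
    (hs : ∀ a ∈ s, a ∈ cutNodes 𝒯 k Ω Ωs) (β : (Space d →₀ ℕ) → ℝ) :
    cutProj 𝒯 k Ω Ωs i (∑ a ∈ s, β a • cutBasis 𝒯 k Ωs a) =
      ∑ a ∈ s with a ∈ cutNodesOf 𝒯 k Ω Ωs i, β a • cutBasis 𝒯 k Ωs a := by
  have hval : ∀ b ∈ cutNodesOf 𝒯 k Ω Ωs i,
      (∑ a ∈ s, β a • cutBasis 𝒯 k Ωs a) (nodePos k b) = if b ∈ s then β b else 0 := by
    intro b hb
    have h1 : ∀ a ∈ s, (β a • cutBasis 𝒯 k Ωs a) (nodePos k b) = if a = b then β a else 0 := by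
      intro a ha
      rw [Pi.smul_apply, cutBasis, Set.indicator_of_mem hb.1.2,
        nodalBasis_nodePos hk (hs a ha).1.1 hb.1.1.1, smul_eq_mul]
      split_ifs <;> simp
    rw [Finset.sum_apply, Finset.sum_congr rfl h1, Finset.sum_ite_eq']
  unfold cutProj
  rw [finsum_mem_congr rfl (fun b hb => by rw [hval b hb])]
  rw [finsum_mem_def, finsum_eq_sum_of_support_subset (s := s)]
  · rw [Finset.sum_filter]
    refine Finset.sum_congr rfl fun a ha => ?_
    by_cases hm : a ∈ cutNodesOf 𝒯 k Ω Ωs i <;> simp [hm, ha]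
  · intro a ha
    by_contra hn
    apply ha
    have hn' : a ∉ s := hn
    simp [hn']

end CutFEM

end

/-! Both norms are sums over the cut cells, since a function of `cutSpace` vanishes off them; hence
everything is local up to passing to neighbouring cells. On a cell of size h all estimates come from
one compactness argument on the reference ball (`exists_sq_norm_le_integral`) and scaling; shape
regularity supplies the inner ball of radius h / σ.

Upper bound: on a cell the projections are bounded in the maximum norm (`abs_cutProj_le`), an
inverse estimate bounds their gradients, and the jump term is bounded because the interface has
measure at most C h ^ (d - 1) in the cell (`exists_interface_measure_le`).

Lower bound: no node lies on Γ, so u = Q₁u + Q₂u, and each Q_i u is to be bounded on a cut cell T.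
Let j be the other index. If T has a vertex outside Ω_j, then Q_i u vanishes there
(`cutProj_vertex`), and a Poincaré estimate suffices. Otherwise all vertices of T lie in Ω_j. Then
the jump is needed, but Γ may cut off only a tiny part of T. The remedy is to follow Γ over a
distance comparable to h: this patch of Γ stays in cut cells that share a vertex with T, their
number is bounded, so one of them, T', carries interface measure at least c h ^ (d - 1)
(`exists_interface_measure_ge`). At a shared vertex v, which lies in Ω_j, Q_j u vanishes; so Q_j u
is controlled on T' by its gradient, the jump transfers this control to Q_i u on T' and hence to Q_i
u at v, and the gradient carries it over to T (`exists_sq_cutProj_le`).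

Two geometric facts make this uniform. Cells at a common vertex in Ω have comparable sizes
(`meshSize_le_of_shared_vertex`), and a path in the closure of Ω that starts in T and is short
relative to h ends only in cells touching T (`inter_nonempty_of_short_path`). Summing over T counts
every cell boundedly often (`sum_patchEnergy_le`). -/

noncomputable section

namespace CutFEM

/-! ### Scale-invariant estimates for polynomials -/

section

variable {d : ℕ}

/-! ### Polynomials of bounded degree -/

/-- The linear map that sends `(l, c)` to the affine function `y ↦ l y + c`. -/
def affineFunctionMap (d : ℕ) : ((Space d →L[ℝ] ℝ) × ℝ) →ₗ[ℝ] (Space d → ℝ) where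
  toFun p y := p.1 y + p.2
  map_add' p q := by
    ext y
    simp only [Prod.fst_add, Prod.snd_add, add_apply, Pi.add_apply]
    ring
  map_smul' c p := by
    ext y
    simp only [Prod.smul_fst, Prod.smul_snd, smul_apply, smul_eq_mul,
      RingHom.id_apply, Pi.smul_apply]
    ring

/-- The space of affine functions on `ℝᵈ`. -/
def affineSpace (d : ℕ) : Submodule ℝ (Space d → ℝ) := LinearMap.range (affineFunctionMap d)

/-- The space of polynomial functions of degree at most `k` on `ℝᵈ`. -/
def polySpace (d k : ℕ) : Submodule ℝ (Space d → ℝ) := affineSpace d ^ k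

theorem mem_affineSpace (l : Space d →L[ℝ] ℝ) (c : ℝ) : (fun y => l y + c) ∈ affineSpace d :=
  ⟨(l, c), rfl⟩

theorem affineMap_mem_affineSpace (f : Space d →ᵃ[ℝ] ℝ) : (f : Space d → ℝ) ∈ affineSpace d := by
  refine ⟨(LinearMap.toContinuousLinearMap f.linear, f 0), ?_⟩
  ext y
  have := f.map_vadd 0 y
  simp only [vadd_eq_add, add_zero] at this
  simp [affineFunctionMap, this]

theorem const_mem_affineSpace (c : ℝ) : (fun _ => c) ∈ affineSpace d := by
  simpa using mem_affineSpace (d := d) 0 c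

/-- Since constants are affine, the powers of `affineSpace` increase; thus the k-th power, taken in
the algebra of functions, contains all degrees up to k and not only products of degree exactly k. -/
theorem one_le_affineSpace : (1 : Submodule ℝ (Space d → ℝ)) ≤ affineSpace d := by
  rw [Submodule.one_le]
  exact const_mem_affineSpace 1

theorem const_mem_polySpace (k : ℕ) (c : ℝ) : (fun _ => c) ∈ polySpace d k := by
  have h : (1 : Submodule ℝ (Space d → ℝ)) ≤ polySpace d k := by
    rw [polySpace, ← one_pow k]
    exact pow_le_pow_left' one_le_affineSpace k
  exact h (Submodule.mem_one.2 ⟨c, rfl⟩)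

theorem polySpace_fg (k : ℕ) : (polySpace d k).FG := by
  refine Submodule.FG.pow ?_ k
  have : (affineSpace d) = (⊤ : Submodule ℝ _).map (affineFunctionMap d) := by
    rw [Submodule.map_top]; rfl
  rw [this]
  exact Submodule.FG.map _ Module.Finite.fg_top

instance (k : ℕ) : FiniteDimensional ℝ (polySpace d k) :=
  Module.Finite.iff_fg.2 (polySpace_fg k)

theorem analyticOnNhd_of_mem_polySpace {k : ℕ} {p : Space d → ℝ} (hp : p ∈ polySpace d k) :
    AnalyticOnNhd ℝ p Set.univ := by
  refine Submodule.pow_induction_on_left (M := affineSpace d) (R := ℝ)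
    (C := fun p => AnalyticOnNhd ℝ p Set.univ) ?_ ?_ ?_ hp
  · intro r
    exact analyticOnNhd_const
  · intro x y hx hy
    exact hx.add hy
  · rintro _ ⟨⟨l, c⟩, rfl⟩ x hx
    refine AnalyticOnNhd.mul ?_ hx
    exact (l.analyticOnNhd _).add analyticOnNhd_const

theorem contDiff_of_mem_polySpace {k : ℕ} {p : Space d → ℝ} (hp : p ∈ polySpace d k) {n} :
    ContDiff ℝ n p :=
  contDiffOn_univ.1 (analyticOnNhd_of_mem_polySpace hp).contDiffOn_of_completeSpace

theorem comp_mem_polySpace {k : ℕ} {p : Space d → ℝ} (hp : p ∈ polySpace d k) (z : Space d)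
    (h : ℝ) : (fun x => p (z + h • x)) ∈ polySpace d k := by
  refine Submodule.pow_induction_on_left' (M := affineSpace d) (R := ℝ)
    (C := fun n p _ => (fun x => p (z + h • x)) ∈ polySpace d n) ?_ ?_ ?_ hp
  · intro r
    exact const_mem_polySpace 0 r
  · intro x y i _ _ hx hy
    exact add_mem hx hy
  · rintro _ ⟨⟨l, c⟩, rfl⟩ i x _ hx
    rw [polySpace, Nat.succ_eq_add_one, pow_succ']
    refine Submodule.mul_mem_mul (m := fun y => affineFunctionMap d (l, c) (z + h • y)) ?_ hx
    have := mem_affineSpace (h • l) (l z + c)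
    convert this using 2 with y
    simp [affineFunctionMap]
    ring

theorem prod_mem_polySpace {ι : Type*} (s : Finset ι) (n : ι → ℕ) (f : ι → Space d → ℝ)
    (hf : ∀ i ∈ s, f i ∈ polySpace d (n i)) : (∏ i ∈ s, f i) ∈ polySpace d (∑ i ∈ s, n i) := by
  classical
  induction s using Finset.induction_on with
  | empty => exact const_mem_polySpace (d := d) 0 1
  | insert a s ha ih =>
    rw [Finset.prod_insert ha, Finset.sum_insert ha, polySpace, pow_add]
    exact Submodule.mul_mem_mul (hf a (Finset.mem_insert_self _ _))
      (ih fun i hi => hf i (Finset.mem_insert_of_mem hi))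

/-- Identity theorem for analytic functions. It gives the injectivity required by the compactness
argument, however small the inner ball is. -/
theorem eq_zero_of_mem_polySpace {k : ℕ} {p : Space d → ℝ} (hp : p ∈ polySpace d k) {ρ : ℝ}
    (hρ : 0 < ρ) (h0 : ∀ y ∈ Metric.ball (0 : Space d) ρ, p y = 0) : p = 0 := by
  have := (analyticOnNhd_of_mem_polySpace hp).eqOn_zero_of_preconnected_of_eventuallyEq_zero
    isPreconnected_univ (Set.mem_univ (0 : Space d))
    (Filter.eventually_of_mem (Metric.ball_mem_nhds _ hρ) h0)
  ext y
  exact this (Set.mem_univ y)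

theorem eq_const_of_mem_polySpace {k : ℕ} {p : Space d → ℝ} (hp : p ∈ polySpace d k) {ρ : ℝ}
    (hρ : 0 < ρ) (h0 : ∀ y ∈ Metric.ball (0 : Space d) ρ, fderiv ℝ p y = 0) (y : Space d) :
    p y = p 0 := by
  have hq : (p - fun _ => p 0) ∈ polySpace d k := sub_mem hp (const_mem_polySpace k _)
  have hz := eq_zero_of_mem_polySpace hq hρ (fun y hy => by
    have hd : DifferentiableOn ℝ p (Metric.ball 0 ρ) :=
      ((contDiff_of_mem_polySpace hp (n := 1)).differentiable (by simp)).differentiableOn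
    have := (convex_ball (0 : Space d) ρ).is_const_of_fderivWithin_eq_zero (𝕜 := ℝ) hd
      (fun x hx => by
        rw [fderivWithin_of_isOpen Metric.isOpen_ball hx, h0 x hx])
      hy (Metric.mem_ball_self hρ)
    simp [this])
  have := congrFun hz y
  simpa [sub_eq_zero] using this

/-! ### Coercivity of `L²` norms on finite-dimensional function spaces -/

section Coercive

universe u

variable {V : Type*} [AddCommGroup V] [Module ℝ V] [FiniteDimensional ℝ V]
  {E E' : Type u} [NormedAddCommGroup E] [NormedSpace ℝ E] [NormedAddCommGroup E']
  [NormedSpace ℝ E']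

/-- Both sides are homogeneous of degree two, so it suffices to consider the unit sphere of
coefficient vectors. There the integral is continuous and positive by injectivity, hence bounded
below, while `G` is bounded above by compactness. The inverse and Poincaré estimates below are
instances with different `F` and `G`. -/
theorem exists_sq_norm_le_integral (F : V →ₗ[ℝ] (Space d → E)) (G : V →ₗ[ℝ] (Space d → E'))
    (hF : ∀ x, Continuous (F x)) (hG : ∀ x, Continuous (G x)) {ρ : ℝ}
    (hinj : ∀ x, (∀ y ∈ Metric.ball (0 : Space d) ρ, F x y = 0) → x = 0) :
    ∃ C : ℝ, 0 < C ∧ ∀ x, ∀ y ∈ Metric.closedBall (0 : Space d) 1,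
      ‖G x y‖ ^ 2 ≤ C * ∫ y in Metric.closedBall (0 : Space d) ρ, ‖F x y‖ ^ 2 := by
  let b := Module.finBasis ℝ V
  set n := Module.finrank ℝ V
  let e : (Fin n → ℝ) ≃ₗ[ℝ] V := b.equivFun.symm
  -- Stated for an arbitrary target because it serves both `F` and `G`; for this reason `E` and `E'`
  -- share a universe.
  have hsum : ∀ {E'' : Type u} [NormedAddCommGroup E''] [NormedSpace ℝ E'']
      (H : V →ₗ[ℝ] (Space d → E'')) (c : Fin n → ℝ) (y : Space d),
      H (e c) y = ∑ i, c i • H (b i) y := by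
    intro E'' _ _ H c y
    simp [e, Module.Basis.equivFun_symm_apply, map_sum]
  have hcont : ∀ {E'' : Type u} [NormedAddCommGroup E''] [NormedSpace ℝ E'']
      (H : V →ₗ[ℝ] (Space d → E'')), (∀ x, Continuous (H x)) →
      Continuous (fun q : (Fin n → ℝ) × Space d => ‖H (e q.1) q.2‖ ^ 2) := by
    intro E'' _ _ H hH
    have hfun : (fun q : (Fin n → ℝ) × Space d => ‖H (e q.1) q.2‖ ^ 2) =
        fun q => ‖∑ i, q.1 i • H (b i) q.2‖ ^ 2 := funext fun q => by rw [hsum H]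
    rw [hfun]
    refine (Continuous.norm (continuous_finsetSum _ fun i _ => ?_)).pow 2
    exact ((continuous_apply i).comp continuous_fst).smul ((hH (b i)).comp continuous_snd)
  have hΦ : Continuous (fun c : Fin n → ℝ =>
      ∫ y in Metric.closedBall (0 : Space d) ρ, ‖F (e c) y‖ ^ 2) :=
    continuous_parametric_integral_of_continuous (f := fun c y => ‖F (e c) y‖ ^ 2)
      (hcont F hF) (isCompact_closedBall _ _)
  have hpos : ∀ c ∈ Metric.sphere (0 : Fin n → ℝ) 1,
      0 < ∫ y in Metric.closedBall (0 : Space d) ρ, ‖F (e c) y‖ ^ 2 := by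
    intro c hc
    have hc0 : e c ≠ 0 := by
      intro h0
      have : c = 0 := by simpa using h0
      simp [this] at hc
    have hne : ∃ y ∈ Metric.ball (0 : Space d) ρ, F (e c) y ≠ 0 := by
      by_contra! hcon
      exact hc0 (hinj _ hcon)
    obtain ⟨y, hy, hyne⟩ := hne
    have hcF : Continuous (fun y => ‖F (e c) y‖ ^ 2) := (hF _).norm.pow 2
    rw [setIntegral_pos_iff_support_of_nonneg_ae
      (Filter.Eventually.of_forall fun y => by positivity)
      (hcF.continuousOn.integrableOn_compact (isCompact_closedBall _ _))]
    have hop : IsOpen ((Function.support fun y => ‖F (e c) y‖ ^ 2) ∩ Metric.ball (0 : Space d) ρ) :=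
      (hcF.isOpen_support).inter Metric.isOpen_ball
    refine lt_of_lt_of_le (hop.measure_pos volume ⟨y, ?_, hy⟩)
      (measure_mono (Set.inter_subset_inter_right _ Metric.ball_subset_closedBall))
    simpa using hyne
  obtain ⟨m, hm, hmle⟩ := (isCompact_sphere (0 : Fin n → ℝ) 1).exists_forall_le'
    hΦ.continuousOn hpos
  obtain ⟨M, hM⟩ := ((isCompact_sphere (0 : Fin n → ℝ) 1).prod
    (isCompact_closedBall (0 : Space d) 1)).exists_bound_of_continuousOn (hcont G hG).continuousOn
  refine ⟨(|M| + 1) / m, by positivity, ?_⟩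
  intro x y hy
  obtain ⟨c, rfl⟩ := e.surjective x
  by_cases hc : c = 0
  · subst hc; simp
  have hcn : 0 < ‖c‖ := norm_pos_iff.2 hc
  have hscale : ∀ {E'' : Type u} [NormedAddCommGroup E''] [NormedSpace ℝ E'']
      (H : V →ₗ[ℝ] (Space d → E'')) (y : Space d),
      ‖H (e c) y‖ ^ 2 = ‖c‖ ^ 2 * ‖H (e (‖c‖⁻¹ • c)) y‖ ^ 2 := by
    intro E'' _ _ H y
    rw [map_smul, map_smul, Pi.smul_apply, norm_smul, norm_inv, norm_norm, mul_pow, ← mul_assoc,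
      ← mul_pow, mul_inv_cancel₀ hcn.ne', one_pow, one_mul]
  have hmem : ‖c‖⁻¹ • c ∈ Metric.sphere (0 : Fin n → ℝ) 1 := by
    simp [norm_smul, hcn.ne']
  have h1 := hmle _ hmem
  have h2 : ‖G (e (‖c‖⁻¹ • c)) y‖ ^ 2 ≤ |M| + 1 := by
    have := hM (‖c‖⁻¹ • c, y) ⟨hmem, hy⟩
    rw [Real.norm_of_nonneg (by positivity)] at this
    linarith [le_abs_self M]
  rw [hscale G]
  simp only [hscale F]
  rw [integral_const_mul]
  calc ‖c‖ ^ 2 * ‖G (e (‖c‖⁻¹ • c)) y‖ ^ 2 ≤ ‖c‖ ^ 2 * (|M| + 1) := by gcongr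
    _ = (|M| + 1) / m * (‖c‖ ^ 2 * m) := by field_simp
    _ ≤ _ := by gcongr

end Coercive

/-! ### Scaled polynomial estimates -/

theorem setIntegral_comp_homothety {E : Type*} [NormedAddCommGroup E] [NormedSpace ℝ E]
    (f : Space d → E) (z : Space d) {h : ℝ} (hh : 0 < h) (ρ : ℝ) :
    ∫ x in Metric.closedBall (0 : Space d) ρ, f (z + h • x) =
      (h ^ d)⁻¹ • ∫ x in Metric.closedBall z (h * ρ), f x := by
  have h1 := Measure.setIntegral_comp_smul_of_pos (volume : Measure (Space d))
    (fun x => f (z + x)) (Metric.closedBall (0 : Space d) ρ) hh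
  rw [h1, finrank_euclideanSpace_fin]
  congr 1
  have h2 := (measurePreserving_add_left (volume : Measure (Space d)) z).setIntegral_preimage_emb
    (MeasurableEquiv.addLeft z).measurableEmbedding f (Metric.closedBall z (h * ρ))
  rw [← h2]
  congr 2
  ext x
  rw [Set.mem_preimage, Metric.mem_closedBall, Set.mem_smul_set_iff_inv_smul_mem₀ hh.ne']
  simp [norm_smul, abs_of_pos hh, inv_mul_le_iff₀ hh]

/-- The derivative as a linear map on polynomial functions. -/
def polyDeriv (k : ℕ) : polySpace d k →ₗ[ℝ] (Space d → (Space d →L[ℝ] ℝ)) where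
  toFun p y := fderiv ℝ (p : Space d → ℝ) y
  map_add' p q := by
    ext1 y
    exact fderiv_add ((contDiff_of_mem_polySpace p.2 (n := 1)).differentiable (by simp) y)
      ((contDiff_of_mem_polySpace q.2 (n := 1)).differentiable (by simp) y)
  map_smul' c p := by
    ext1 y
    exact fderiv_const_smul ((contDiff_of_mem_polySpace p.2 (n := 1)).differentiable (by simp) y) c

theorem continuous_fderiv_polySpace {k : ℕ} {p : Space d → ℝ} (hp : p ∈ polySpace d k) :
    Continuous (fderiv ℝ p) :=
  (contDiff_of_mem_polySpace hp (n := 1)).continuous_fderiv (by simp)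

theorem continuous_of_mem_polySpace {k : ℕ} {p : Space d → ℝ} (hp : p ∈ polySpace d k) :
    Continuous p :=
  (contDiff_of_mem_polySpace hp (n := 1)).continuous

theorem fderiv_comp_homothety {p : Space d → ℝ} (hp : Differentiable ℝ p) (z : Space d) (h : ℝ)
    (x : Space d) : fderiv ℝ (fun x => p (z + h • x)) x = h • fderiv ℝ p (z + h • x) := by
  have h1 : HasFDerivAt (fun x : Space d => z + h • x) (h • ContinuousLinearMap.id ℝ (Space d)) x :=
    ((hasFDerivAt_id x).const_smul h).const_add z
  have h2 := (hp (z + h • x)).hasFDerivAt.comp x h1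
  have h3 := h2.fderiv
  simp only [Function.comp_def] at h3
  rw [h3]
  ext v
  simp

/-- The point `y` in the coordinates of the closed ball of radius `h` around `z`. -/
theorem exists_homothety_eq {z y : Space d} {h : ℝ} (hh : 0 < h) (hy : dist y z ≤ h) :
    ∃ x ∈ Metric.closedBall (0 : Space d) 1, z + h • x = y := by
  refine ⟨h⁻¹ • (y - z), ?_, ?_⟩
  · rw [mem_closedBall_zero_iff, norm_smul, norm_inv, Real.norm_of_nonneg hh.le, ← dist_eq_norm,
      inv_mul_le_iff₀ hh, mul_one]
    exact hy
  · rw [smul_smul, mul_inv_cancel₀ hh.ne', one_smul, add_sub_cancel]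

/-- The compactness estimate transported by x ↦ z + h x. In the application `s` is a cell, `z` the
centre of its inscribed ball, `h` its diameter and ρ = 1 / σ, so the large ball contains the cell.
-/
theorem exists_sq_le_integral_sq (d k : ℕ) {ρ : ℝ} (hρ : 0 < ρ) :
    ∃ C : ℝ, 0 < C ∧ ∀ p ∈ polySpace d k, ∀ (z : Space d) (h : ℝ), 0 < h → ∀ s : Set (Space d),
      IsCompact s → Metric.closedBall z (h * ρ) ⊆ s → ∀ y, dist y z ≤ h →
      p y ^ 2 ≤ C * ((h ^ d)⁻¹ * ∫ x in s, p x ^ 2) := by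
  obtain ⟨C, hC, hle⟩ := exists_sq_norm_le_integral (polySpace d k).subtype (polySpace d k).subtype
    (fun p => continuous_of_mem_polySpace p.2) (fun p => continuous_of_mem_polySpace p.2)
    (fun p hp => Subtype.ext (eq_zero_of_mem_polySpace p.2 hρ hp))
  refine ⟨C, hC, ?_⟩
  intro p hp z h hh s hs hzs y hy
  obtain ⟨x, hx, rfl⟩ := exists_homothety_eq hh hy
  have h1 := hle ⟨_, comp_mem_polySpace hp z h⟩ x hx
  simp only [Submodule.subtype_apply, Real.norm_eq_abs, sq_abs] at h1
  rw [setIntegral_comp_homothety (fun x => p x ^ 2) z hh ρ, smul_eq_mul] at h1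
  refine h1.trans ?_
  gcongr
  · exact Filter.Eventually.of_forall fun x => sq_nonneg _
  · exact ((continuous_of_mem_polySpace hp).pow 2).continuousOn.integrableOn_compact hs

theorem exists_sq_fderiv_le_integral_sq (d k : ℕ) {ρ : ℝ} (hρ : 0 < ρ) :
    ∃ C : ℝ, 0 < C ∧ ∀ p ∈ polySpace d k, ∀ (z : Space d) (h : ℝ), 0 < h → ∀ s : Set (Space d),
      IsCompact s → Metric.closedBall z (h * ρ) ⊆ s → ∀ y, dist y z ≤ h →
      h ^ 2 * ‖fderiv ℝ p y‖ ^ 2 ≤ C * ((h ^ d)⁻¹ * ∫ x in s, p x ^ 2) := by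
  obtain ⟨C, hC, hle⟩ := exists_sq_norm_le_integral (polySpace d k).subtype (polyDeriv k)
    (fun p => continuous_of_mem_polySpace p.2) (fun p => continuous_fderiv_polySpace p.2)
    (fun p hp => Subtype.ext (eq_zero_of_mem_polySpace p.2 hρ hp))
  refine ⟨C, hC, ?_⟩
  intro p hp z h hh s hs hzs y hy
  obtain ⟨x, hx, rfl⟩ := exists_homothety_eq hh hy
  have h1 := hle ⟨_, comp_mem_polySpace hp z h⟩ x hx
  simp only [Submodule.subtype_apply, Real.norm_eq_abs, sq_abs, polyDeriv, LinearMap.coe_mk,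
    AddHom.coe_mk] at h1
  rw [setIntegral_comp_homothety (fun x => p x ^ 2) z hh ρ, smul_eq_mul, fderiv_comp_homothety
    ((contDiff_of_mem_polySpace hp (n := 1)).differentiable (by simp)), norm_smul, mul_pow,
    Real.norm_eq_abs, sq_abs] at h1
  refine h1.trans ?_
  gcongr
  · exact Filter.Eventually.of_forall fun x => sq_nonneg _
  · exact ((continuous_of_mem_polySpace hp).pow 2).continuousOn.integrableOn_compact hs

theorem exists_sq_sub_le_integral_sq_fderiv (d k : ℕ) {ρ : ℝ} (hρ : 0 < ρ) :
    ∃ C : ℝ, 0 < C ∧ ∀ p ∈ polySpace d k, ∀ (z : Space d) (h : ℝ), 0 < h → ∀ s : Set (Space d),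
      IsCompact s → Metric.closedBall z (h * ρ) ⊆ s → ∀ y y', dist y z ≤ h → dist y' z ≤ h →
      (p y - p y') ^ 2 ≤ C * (h ^ 2 * ((h ^ d)⁻¹ * ∫ x in s, ‖fderiv ℝ p x‖ ^ 2)) := by
  -- The derivative is injective only modulo constants, so the argument runs on the polynomials that
  -- vanish at the centre.
  let V : Submodule ℝ (polySpace d k) :=
    LinearMap.ker ((LinearMap.proj (0 : Space d)).comp (polySpace d k).subtype)
  obtain ⟨C, hC, hle⟩ := exists_sq_norm_le_integral (V := V) ((polyDeriv k).comp V.subtype)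
    ((polySpace d k).subtype.comp V.subtype)
    (fun p => continuous_fderiv_polySpace p.1.2) (fun p => continuous_of_mem_polySpace p.1.2)
    (fun p hp => by
      refine Subtype.ext (Subtype.ext (funext fun y => ?_))
      have h0 : (p.1 : Space d → ℝ) 0 = 0 := p.2
      have := eq_const_of_mem_polySpace p.1.2 hρ hp y
      rw [this, h0]; rfl)
  -- Both values are compared with the value at the centre `z`, and (a - b)² ≤ 2a² + 2b².
  refine ⟨4 * C, by positivity, ?_⟩
  intro p hp z h hh s hs hzs y y' hy hy'
  have key : ∀ y, dist y z ≤ h →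
      (p y - p z) ^ 2 ≤ C * (h ^ 2 * ((h ^ d)⁻¹ * ∫ x in s, ‖fderiv ℝ p x‖ ^ 2)) := by
    intro y hy
    obtain ⟨x, hx, rfl⟩ := exists_homothety_eq hh hy
    have hpd := (contDiff_of_mem_polySpace hp (n := 1)).differentiable (by simp)
    have hq : ((fun x => p (z + h • x)) - fun _ => p z) ∈ polySpace d k :=
      sub_mem (comp_mem_polySpace hp z h) (const_mem_polySpace k _)
    have h1 := hle ⟨⟨_, hq⟩, by simp [V]⟩ x hx
    have hfd : ∀ x, fderiv ℝ ((fun x => p (z + h • x)) - fun _ => p z) x =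
        h • fderiv ℝ p (z + h • x) := by
      intro x
      rw [← fderiv_comp_homothety hpd]
      exact fderiv_sub_const _
    simp only [LinearMap.comp_apply, Submodule.subtype_apply, Real.norm_eq_abs, sq_abs, polyDeriv,
      LinearMap.coe_mk, AddHom.coe_mk, hfd, norm_smul, mul_pow, Pi.sub_apply] at h1
    rw [integral_const_mul, setIntegral_comp_homothety (fun x => ‖fderiv ℝ p x‖ ^ 2) z hh ρ,
      smul_eq_mul] at h1
    refine h1.trans ?_
    gcongr
    · exact Filter.Eventually.of_forall fun x => sq_nonneg _
    · exact ((continuous_fderiv_polySpace hp).norm.pow 2).continuousOn.integrableOn_compact hs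
  have h1 := key y hy
  have h2 := key y' hy'
  nlinarith [sq_nonneg ((p y - p z) + (p y' - p z))]

end

/-! ### Geometry of shape-regular cells -/

section

variable {d : ℕ}

/-! ### Barycentric coordinates -/

variable {𝒯 : Geometry.SimplicialComplex ℝ (Space d)}

open Classical in
theorem exists_isBarycentric {s : Finset (Space d)} (hs : s ∈ 𝒯.faces) {y : Space d}
    (hy : y ∈ simplex s) : ∃ w, IsBarycentric 𝒯 y w ∧ (∀ v ∉ s, w v = 0) ∧ (∀ v, 0 ≤ w v) ∧
      ∑ v ∈ s, w v = 1 := by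
  obtain ⟨w, hn, h1, hwy⟩ := Finset.mem_convexHull'.1 hy
  refine ⟨fun v => if v ∈ s then w v else 0, ⟨s, hs, ?_, ?_, ?_, ?_⟩, ?_, ?_, ?_⟩
  · intro v hv; simp [hv]
  · intro v hv; simp [hv, hn v hv]
  · rw [← h1]; exact Finset.sum_congr rfl fun v hv => by simp [hv]
  · rw [← hwy]; exact Finset.sum_congr rfl fun v hv => by simp [hv]
  · intro v hv; simp [hv]
  · intro v
    by_cases hv : v ∈ s
    · simp [hv, hn v hv]
    · simp [hv]
  · rw [← h1]; exact Finset.sum_congr rfl fun v hv => by simp [hv]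

theorem baryCoord_nonneg {s : Finset (Space d)} (hs : s ∈ 𝒯.faces) {y : Space d}
    (hy : y ∈ simplex s) (v : Space d) : 0 ≤ baryCoord 𝒯 v y := by
  obtain ⟨w, hw, -, hn, -⟩ := exists_isBarycentric hs hy
  rw [hw.baryCoord_eq]
  exact hn v

theorem baryCoord_eq_zero {s : Finset (Space d)} (hs : s ∈ 𝒯.faces) {y : Space d}
    (hy : y ∈ simplex s) {v : Space d} (hv : v ∉ s) : baryCoord 𝒯 v y = 0 := by
  obtain ⟨w, hw, h0, -, -⟩ := exists_isBarycentric hs hy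
  rw [hw.baryCoord_eq]
  exact h0 v hv

theorem sum_baryCoord {s : Finset (Space d)} (hs : s ∈ 𝒯.faces) {y : Space d}
    (hy : y ∈ simplex s) : ∑ v ∈ s, baryCoord 𝒯 v y = 1 := by
  obtain ⟨w, hw, -, -, h1⟩ := exists_isBarycentric hs hy
  simp only [hw.baryCoord_eq]
  exact h1

theorem baryCoord_le_one {s : Finset (Space d)} (hs : s ∈ 𝒯.faces) {y : Space d}
    (hy : y ∈ simplex s) (v : Space d) : baryCoord 𝒯 v y ≤ 1 := by
  by_cases hv : v ∈ s
  · rw [← sum_baryCoord hs hy]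
    exact Finset.single_le_sum (f := fun v => baryCoord 𝒯 v y)
      (fun v _ => baryCoord_nonneg hs hy v) hv
  · rw [baryCoord_eq_zero hs hy hv]; exact zero_le_one

theorem baryCoord_self {s : Finset (Space d)} (hs : s ∈ 𝒯.faces) {v : Space d} (hv : v ∈ s) :
    baryCoord 𝒯 v v = 1 := by
  have hface : {v} ∈ 𝒯.faces := 𝒯.down_closed hs (Finset.singleton_subset_iff.2 hv) (by simp)
  have := sum_baryCoord (𝒯 := 𝒯) hface (y := v) (by simp [simplex])
  simpa using this

theorem baryCoord_vertex {s : Finset (Space d)} (hs : s ∈ 𝒯.faces) {v w : Space d} (hw : w ∈ s)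
    (hvw : v ≠ w) : baryCoord 𝒯 v w = 0 := by
  have hface : {w} ∈ 𝒯.faces := 𝒯.down_closed hs (Finset.singleton_subset_iff.2 hw) (by simp)
  exact baryCoord_eq_zero hface (y := w) (by simp [simplex]) (by simpa using hvw)

theorem affineSpan_eq_top_of_mem_cells {t : Finset (Space d)} (ht : t ∈ cells 𝒯) :
    affineSpan ℝ (t : Set (Space d)) = ⊤ := by
  have h1 := (𝒯.indep ht.1).affineSpan_eq_top_iff_card_eq_finrank_add_one.2
    (by simpa using ht.2)
  simpa using h1

/-- The d + 1 vertices of a cell form an affine basis, whose coordinate functions are affine;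
vertices of other cells contribute zero. -/
theorem exists_affineMap_eq_baryCoord {t : Finset (Space d)} (ht : t ∈ cells 𝒯) (v : Space d) :
    ∃ l : Space d →ᵃ[ℝ] ℝ, ∀ y ∈ simplex t, baryCoord 𝒯 v y = l y := by
  by_cases hv : v ∈ t
  · let b : AffineBasis t ℝ (Space d) :=
      ⟨((↑) : t → Space d), 𝒯.indep ht.1, by simpa using affineSpan_eq_top_of_mem_cells ht⟩
    refine ⟨b.coord ⟨v, hv⟩, ?_⟩
    intro y hy
    obtain ⟨w, hn, h1, hwy⟩ := Finset.mem_convexHull'.1 hy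
    have h1' : ∑ u : t, w u = 1 := by rw [Finset.sum_coe_sort t w, h1]
    have hy' : y = Finset.univ.affineCombination ℝ b (fun u : t => w u) := by
      rw [Finset.affineCombination_eq_linear_combination _ _ _ h1', ← hwy]
      exact (Finset.sum_coe_sort t (fun u => w u • u)).symm
    have hbar : IsBarycentric 𝒯 y (fun u => if hu : u ∈ t then b.coord ⟨u, hu⟩ y else 0) := by
      have hc : ∀ u (hu : u ∈ t), b.coord ⟨u, hu⟩ y = w u := by
        intro u hu
        rw [hy', b.coord_apply_combination_of_mem (Finset.mem_univ _) h1']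
      refine ⟨t, ht.1, ?_, ?_, ?_, ?_⟩
      · intro u hu; simp [hu]
      · intro u hu; simp only [hu, dite_true, hc]; exact hn u hu
      · rw [← h1]; exact Finset.sum_congr rfl fun u hu => by simp only [hu, dite_true, hc]
      · exact (Finset.sum_congr rfl fun u hu => by simp only [hu, dite_true, hc]).trans hwy
    rw [hbar.baryCoord_eq]
    simp [hv]
  · exact ⟨0, fun y hy => by simpa using baryCoord_eq_zero ht.1 hy hv⟩

/-! ### Geometry of a single cell -/

theorem isCompact_simplex (t : Finset (Space d)) : IsCompact (simplex t) :=
  t.finite_toSet.isCompact_convexHull (𝕜 := ℝ)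

theorem isClosed_simplex (t : Finset (Space d)) : IsClosed (simplex t) :=
  (isCompact_simplex t).isClosed

theorem measurableSet_simplex (t : Finset (Space d)) : MeasurableSet (simplex t) :=
  (isClosed_simplex t).measurableSet

theorem convex_simplex (t : Finset (Space d)) : Convex ℝ (simplex t) := convex_convexHull ℝ _

theorem subset_simplex (t : Finset (Space d)) : (t : Set (Space d)) ⊆ simplex t :=
  subset_convexHull ℝ _

theorem dist_le_meshSize {t : Finset (Space d)} {x y : Space d} (hx : x ∈ simplex t)
    (hy : y ∈ simplex t) : dist x y ≤ meshSize t :=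
  Metric.dist_le_diam_of_mem (isCompact_simplex t).isBounded hx hy

theorem meshSize_pos (hd : 1 ≤ d) {t : Finset (Space d)} (ht : t ∈ cells 𝒯) : 0 < meshSize t := by
  obtain ⟨v, hv, w, hw, hvw⟩ := Finset.one_lt_card.1 (show 1 < t.card by rw [ht.2]; omega)
  exact (dist_pos.2 hvw).trans_le (dist_le_meshSize (subset_simplex t hv) (subset_simplex t hw))

/-- A barycentric coordinate is affine on the cell with values in [0, 1], and the cell contains a
ball of radius h / σ. A step of that length from the centre therefore changes it by at most 1, so
its Lipschitz constant is at most σ / h. -/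
theorem meshSize_mul_abs_baryCoord_sub_le {σ : ℝ} (hσ : 0 < σ) (hT : IsShapeRegular σ 𝒯)
    {t : Finset (Space d)} (ht : t ∈ cells 𝒯) (v : Space d) {y y' : Space d}
    (hy : y ∈ simplex t) (hy' : y' ∈ simplex t) :
    meshSize t * |baryCoord 𝒯 v y - baryCoord 𝒯 v y'| ≤ σ * dist y y' := by
  obtain ⟨z, hz⟩ := hT t ht
  obtain ⟨l, hl⟩ := exists_affineMap_eq_baryCoord ht v
  have hh : 0 ≤ meshSize t := Metric.diam_nonneg
  rw [hl y hy, hl y' hy']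
  by_cases hyy : y = y'
  · simp [hyy]
  have hpos : 0 < dist y y' := dist_pos.2 hyy
  have hzt : z ∈ simplex t := hz (Metric.mem_closedBall_self (by positivity))
  -- Chosen so that c (y - y') has length exactly h / σ, the radius of the inscribed ball.
  let c : ℝ := meshSize t / σ / dist y y'
  have hc : 0 ≤ c := by positivity
  have hx : z + c • (y - y') ∈ simplex t := by
    refine hz ?_
    rw [Metric.mem_closedBall, dist_eq_norm, add_sub_cancel_left, norm_smul, ← dist_eq_norm,
      Real.norm_of_nonneg hc]
    simp only [c]
    rw [div_mul_cancel₀ _ hpos.ne']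
  have h1 := baryCoord_nonneg ht.1 hzt v
  have h2 := baryCoord_nonneg ht.1 hx v
  have h3 := baryCoord_le_one ht.1 hzt v
  have h4 := baryCoord_le_one ht.1 hx v
  rw [hl z hzt] at h1 h3
  rw [hl _ hx] at h2 h4
  have h5 : l (z + c • (y - y')) = l z + c * (l y - l y') := by
    have e1 := l.map_vadd z (c • (y - y'))
    have e2 := l.linearMap_vsub y y'
    simp only [vadd_eq_add, vsub_eq_sub] at e1 e2
    rw [add_comm z, e1, map_smul, e2, smul_eq_mul, add_comm]
  rw [h5] at h2 h4
  have h6 : c * |l y - l y'| ≤ 1 := by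
    rw [← abs_of_nonneg hc, ← abs_mul, abs_le]
    constructor <;> linarith
  have h7 : c * (σ * dist y y') = meshSize t := by
    simp only [c]; field_simp
  rw [← h7]
  calc c * (σ * dist y y') * |l y - l y'| = (σ * dist y y') * (c * |l y - l y'|) := by ring
    _ ≤ (σ * dist y y') * 1 := by gcongr
    _ = _ := mul_one _

/-- The coordinate of `v` drops from 1 to 0 along the edge, so the Lipschitz bound prevents the edge
from being short. -/
theorem meshSize_le_mul_dist {σ : ℝ} (hσ : 0 < σ) (hT : IsShapeRegular σ 𝒯)
    {t : Finset (Space d)} (ht : t ∈ cells 𝒯) {v w : Space d} (hv : v ∈ t) (hw : w ∈ t)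
    (hvw : v ≠ w) : meshSize t ≤ σ * dist v w := by
  have := meshSize_mul_abs_baryCoord_sub_le hσ hT ht v (subset_simplex t hv) (subset_simplex t hw)
  rwa [baryCoord_self ht.1 hv, baryCoord_vertex ht.1 hw hvw, sub_zero, abs_one, mul_one] at this

theorem nonempty_interior_simplex (hd : 1 ≤ d) {σ : ℝ} (hσ : 0 < σ) (hT : IsShapeRegular σ 𝒯)
    {t : Finset (Space d)} (ht : t ∈ cells 𝒯) : (interior (simplex t)).Nonempty := by
  obtain ⟨z, hz⟩ := hT t ht
  have := meshSize_pos hd ht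
  exact ⟨z, interior_mono (Metric.ball_subset_closedBall.trans hz)
    (by rw [Metric.isOpen_ball.interior_eq]; exact Metric.mem_ball_self (by positivity))⟩

theorem closure_interior_simplex (hd : 1 ≤ d) {σ : ℝ} (hσ : 0 < σ) (hT : IsShapeRegular σ 𝒯)
    {t : Finset (Space d)} (ht : t ∈ cells 𝒯) : closure (interior (simplex t)) = simplex t := by
  rw [(convex_simplex t).closure_interior_eq_closure_of_nonempty_interior
    (nonempty_interior_simplex hd hσ hT ht), (isClosed_simplex t).closure_eq]

/-! ### Pairs of cells -/

open Classical in
theorem simplex_inter_subset {s t : Finset (Space d)} (hs : s ∈ 𝒯.faces) (ht : t ∈ 𝒯.faces) :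
    simplex s ∩ simplex t ⊆ simplex (s ∩ t) := by
  intro x hx
  have := 𝒯.inter_subset_convexHull hs ht hx
  rwa [← Finset.coe_inter] at this

/-- The intersection lies in the hull of the common vertices. These are fewer than d + 1, so they
span a proper affine subspace, which is a null set. -/
theorem volume_simplex_inter {s t : Finset (Space d)} (hs : s ∈ cells 𝒯) (ht : t ∈ cells 𝒯)
    (hst : s ≠ t) : volume (simplex s ∩ simplex t) = 0 := by
  classical
  refine measure_mono_null (simplex_inter_subset hs.1 ht.1) ?_
  refine measure_mono_null (convexHull_subset_affineSpan _) ?_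
  refine Measure.addHaar_affineSubspace _ _ ?_
  intro htop
  have hsub : ((s ∩ t : Finset (Space d)) : Set (Space d)) ⊆ s := by simp
  have hind : AffineIndependent ℝ ((↑) : (s ∩ t : Finset (Space d)) → Space d) :=
    (𝒯.indep hs.1).mono hsub
  have hcard := hind.affineSpan_eq_top_iff_card_eq_finrank_add_one.1 (by
    simpa only [Subtype.range_coe_subtype, Finset.setOfPred_mem] using htop)
  rw [Fintype.card_coe, finrank_euclideanSpace_fin, ← hs.2] at hcard
  have h1 : s ∩ t = s := Finset.eq_of_subset_of_card_le Finset.inter_subset_left hcard.ge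
  have h2 : s ⊆ t := Finset.inter_eq_left.1 h1
  exact hst (Finset.eq_of_subset_of_card_le h2 (by rw [hs.2, ht.2]))

theorem interior_simplex_inter (hd : 1 ≤ d) {σ : ℝ} (hσ : 0 < σ) (hT : IsShapeRegular σ 𝒯)
    {s t : Finset (Space d)} (hs : s ∈ cells 𝒯) (ht : t ∈ cells 𝒯) (hst : s ≠ t) :
    interior (simplex s) ∩ simplex t = ∅ := by
  by_contra hne
  obtain ⟨x, hx, hxt⟩ := Set.nonempty_iff_ne_empty.2 hne
  rw [← closure_interior_simplex hd hσ hT ht] at hxt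
  have hne' := mem_closure_iff.1 hxt _ isOpen_interior hx
  have hpos := (isOpen_interior.inter isOpen_interior).measure_pos volume hne'
  exact hpos.ne' (measure_mono_null (Set.inter_subset_inter interior_subset interior_subset)
    (volume_simplex_inter hs ht hst))

/-! ### The number of cells at a vertex -/

/-- The homothety with centre `v` and ratio ε / h maps the cell into itself, by convexity, and
shrinks its inscribed ball to radius ε / σ. -/
theorem exists_closedBall_subset_scaled {σ : ℝ} {t : Finset (Space d)} {v : Space d} (hv : v ∈ t)
    {z : Space d} (hz : Metric.closedBall z (meshSize t / σ) ⊆ simplex t) {ε : ℝ} (hε : 0 < ε)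
    (hεt : ε ≤ meshSize t) :
    ∃ z', Metric.closedBall z' (ε / σ) ⊆ simplex t ∩ Metric.closedBall v ε := by
  have hh : 0 < meshSize t := hε.trans_le hεt
  refine ⟨v + (ε / meshSize t) • (z - v), ?_⟩
  intro y hy
  let x : Space d := v + (meshSize t / ε) • (y - v)
  have hyx : y = v + (ε / meshSize t) • (x - v) := by
    simp only [x, add_sub_cancel_left, smul_smul]
    rw [show ε / meshSize t * (meshSize t / ε) = 1 by field_simp, one_smul, add_sub_cancel]
  have hxz : x - z = (meshSize t / ε) • (y - (v + (ε / meshSize t) • (z - v))) := by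
    simp only [x, smul_sub, smul_add, smul_smul]
    rw [show meshSize t / ε * (ε / meshSize t) = 1 by field_simp]
    simp only [one_smul]
    abel
  have hx : x ∈ simplex t := by
    apply hz
    rw [Metric.mem_closedBall, dist_eq_norm] at hy ⊢
    rw [hxz, norm_smul, Real.norm_of_nonneg (by positivity)]
    calc meshSize t / ε * ‖y - (v + (ε / meshSize t) • (z - v))‖ ≤ meshSize t / ε * (ε / σ) := by
          gcongr
      _ = meshSize t / σ := by field_simp
  have hvt := subset_simplex t hv
  constructor
  · rw [hyx]
    exact (convex_simplex t).add_smul_sub_mem hvt hx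
      ⟨by positivity, by rw [div_le_one hh]; exact hεt⟩
  · rw [Metric.mem_closedBall, dist_eq_norm, hyx, add_sub_cancel_left, norm_smul,
      Real.norm_of_nonneg (by positivity), ← dist_eq_norm]
    calc ε / meshSize t * dist x v ≤ ε / meshSize t * meshSize t := by
          gcongr; exact dist_le_meshSize hx hvt
      _ = ε := by field_simp

/-- Volume packing: with ε the smallest size among these cells, each contains a ball of radius ε / σ
within distance ε of `v`. These balls overlap only in null sets and all lie in the ball of radius ε.
-/
theorem card_cells_le (hd : 1 ≤ d) {σ : ℝ} (hσ : 0 < σ) (hT : IsShapeRegular σ 𝒯) (v : Space d)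
    (F : Finset (Finset (Space d))) (hF : ∀ t ∈ F, t ∈ cells 𝒯 ∧ v ∈ t) :
    (F.card : ℝ) ≤ σ ^ d := by
  rcases F.eq_empty_or_nonempty with rfl | hne
  · simp only [Finset.card_empty, Nat.cast_zero]; positivity
  obtain ⟨t₀, ht₀, hmin⟩ := F.exists_min_image meshSize hne
  have hε := meshSize_pos hd (hF t₀ ht₀).1
  set ε := meshSize t₀
  have hex : ∀ t, ∃ z', t ∈ F →
      Metric.closedBall z' (ε / σ) ⊆ simplex t ∩ Metric.closedBall v ε := by
    intro t
    by_cases ht : t ∈ F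
    · obtain ⟨z, hz⟩ := hT t (hF t ht).1
      obtain ⟨z', hz'⟩ := exists_closedBall_subset_scaled (hF t ht).2 hz hε (hmin t ht)
      exact ⟨z', fun _ => hz'⟩
    · exact ⟨0, fun h => absurd h ht⟩
  choose z hz using hex
  have hdisj : Set.Pairwise (F : Set (Finset (Space d)))
      (Function.onFun (AEDisjoint volume) fun t => Metric.closedBall (z t) (ε / σ)) := by
    intro s hs t ht hst
    exact measure_mono_null
      (Set.inter_subset_inter ((hz s hs).trans Set.inter_subset_left)
        ((hz t ht).trans Set.inter_subset_left))
      (volume_simplex_inter (hF s hs).1 (hF t ht).1 hst)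
  have hmeas := measure_biUnion_finset₀ hdisj
    (fun t _ => (measurableSet_closedBall (x := z t) (ε := ε / σ)).nullMeasurableSet)
  have hle : volume (⋃ t ∈ F, Metric.closedBall (z t) (ε / σ)) ≤ volume (Metric.closedBall v ε) :=
    measure_mono (Set.iUnion₂_subset fun t ht => (hz t ht).trans Set.inter_subset_right)
  rw [hmeas] at hle
  simp only [Measure.addHaar_closedBall _ _ hε.le, Measure.addHaar_closedBall _ _
    (show (0 : ℝ) ≤ ε / σ by positivity), finrank_euclideanSpace_fin, Finset.sum_const,
    nsmul_eq_mul, ← mul_assoc] at hle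
  have hb0 : volume (Metric.ball (0 : Space d) 1) ≠ 0 :=
    (Metric.measure_ball_pos _ _ one_pos).ne'
  have hbt : volume (Metric.ball (0 : Space d) 1) ≠ ⊤ := measure_ball_lt_top.ne
  rw [ENNReal.mul_le_mul_iff_left hb0 hbt, ← ENNReal.ofReal_natCast,
    ← ENNReal.ofReal_mul (by positivity), ENNReal.ofReal_le_ofReal_iff (by positivity), div_pow]
    at hle
  have hεd : 0 < ε ^ d := by positivity
  have hσd : 0 < σ ^ d := by positivity
  rw [mul_div_assoc', div_le_iff₀ hσd, mul_comm] at hle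
  exact le_of_mul_le_mul_left hle hεd

end

/-! ### Comparison of neighbouring cells -/

section

variable {d : ℕ} {𝒯 : Geometry.SimplicialComplex ℝ (Space d)}

/-! ### Local quasi-uniformity at interior vertices -/

theorem finite_cells {Ω : Set (Space d)} (h𝒯 : IsTriangulation 𝒯 Ω) : (cells 𝒯).Finite :=
  h𝒯.finite.subset fun _ ht => ht.1

theorem exists_cell_of_mem_closure {Ω : Set (Space d)} (h𝒯 : IsTriangulation 𝒯 Ω) {x : Space d}
    (hx : x ∈ closure Ω) : ∃ t ∈ cells 𝒯, x ∈ simplex t := by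
  rw [← h𝒯.space_eq] at hx
  obtain ⟨s, hs, hxs⟩ := Geometry.SimplicialComplex.mem_space_iff.1 hx
  obtain ⟨t, ht, hst⟩ := h𝒯.pure s hs
  exact ⟨t, ht, convexHull_mono (by exact_mod_cast hst) hxs⟩

theorem simplex_subset_closure {Ω : Set (Space d)} (h𝒯 : IsTriangulation 𝒯 Ω)
    {t : Finset (Space d)} (ht : t ∈ cells 𝒯) : simplex t ⊆ closure Ω := by
  rw [← h𝒯.space_eq]
  exact 𝒯.convexHull_subset_space ht.1

theorem exists_ball_inter_simplex {Ω : Set (Space d)} (h𝒯 : IsTriangulation 𝒯 Ω) (x : Space d) :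
    ∃ ε > 0, ∀ t ∈ cells 𝒯, (Metric.ball x ε ∩ simplex t).Nonempty → x ∈ simplex t := by
  have hfin : {t | t ∈ cells 𝒯 ∧ x ∉ simplex t}.Finite :=
    (finite_cells h𝒯).subset fun _ ht => ht.1
  have hcl : IsClosed (⋃ t ∈ {t | t ∈ cells 𝒯 ∧ x ∉ simplex t}, simplex t) :=
    hfin.isClosed_biUnion fun t _ => isClosed_simplex t
  have hx : x ∈ (⋃ t ∈ {t | t ∈ cells 𝒯 ∧ x ∉ simplex t}, simplex t)ᶜ := by
    simp only [Set.mem_compl_iff, Set.mem_iUnion, not_exists]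
    exact fun t ht => ht.2
  obtain ⟨ε, hε, hsub⟩ := Metric.isOpen_iff.1 hcl.isOpen_compl x hx
  refine ⟨ε, hε, ?_⟩
  rintro t ht ⟨y, hy, hyt⟩
  by_contra hxt
  exact hsub hy (Set.mem_biUnion (show t ∈ {t | t ∈ cells 𝒯 ∧ x ∉ simplex t} from ⟨ht, hxt⟩) hyt)

theorem mem_of_mem_simplex {s t : Finset (Space d)} (hs : s ∈ 𝒯.faces) (ht : t ∈ 𝒯.faces)
    {v : Space d} (hv : v ∈ s) (hvt : v ∈ simplex t) : v ∈ t := by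
  by_contra h
  have h1 := baryCoord_eq_zero ht hvt h
  rw [baryCoord_self hs hv] at h1
  exact one_ne_zero h1

/-- For d ≥ 2 a small sphere around an interior vertex is connected, and the cells at `v` cover it.
Hence the cells in `A` and those outside meet at a point of the sphere; as this point differs from
`v`, the common face has a second vertex. At a boundary vertex the link could be disconnected, which
is why v ∈ Ω is required. -/
theorem exists_shared_edge (hd : 2 ≤ d) {Ω : Set (Space d)} (hΩ : IsOpen Ω)
    (h𝒯 : IsTriangulation 𝒯 Ω) {v : Space d} (hv : v ∈ Ω) (A : Set (Finset (Space d)))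
    {t₀ t₁ : Finset (Space d)} (h₀ : t₀ ∈ cells 𝒯) (hv₀ : v ∈ t₀) (hA₀ : t₀ ∈ A)
    (h₁ : t₁ ∈ cells 𝒯) (hv₁ : v ∈ t₁) (hA₁ : t₁ ∉ A) :
    ∃ t ∈ cells 𝒯, ∃ t' ∈ cells 𝒯, v ∈ t ∧ v ∈ t' ∧ t ∈ A ∧ t' ∉ A ∧
      ∃ w ∈ t, w ∈ t' ∧ v ≠ w := by
  classical
  obtain ⟨ε₁, hε₁, hloc⟩ := exists_ball_inter_simplex h𝒯 v
  obtain ⟨ε₂, hε₂, hball⟩ := Metric.isOpen_iff.1 hΩ v hv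
  have hvertex : ∀ t ∈ cells 𝒯, ∃ w ∈ t, w ≠ v := fun t ht =>
    Finset.exists_mem_ne (show 1 < t.card by rw [ht.2]; omega) v
  obtain ⟨w₀, hw₀, hwv₀⟩ := hvertex t₀ h₀
  obtain ⟨w₁, hw₁, hwv₁⟩ := hvertex t₁ h₁
  have hd₀ := dist_pos.2 hwv₀
  have hd₁ := dist_pos.2 hwv₁
  -- The sphere of radius δ lies in Ω, meets only cells that contain `v`, and is small enough to be
  -- crossed by an edge of `t₀` and an edge of `t₁`.
  let δ : ℝ := min (min (ε₁ / 2) (ε₂ / 2)) (min (dist w₀ v) (dist w₁ v))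
  have hδ : 0 < δ := by simp only [δ, lt_min_iff]; exact ⟨⟨by positivity, by positivity⟩, hd₀, hd₁⟩
  have hδ₁ : δ < ε₁ :=
    ((min_le_left _ _).trans (min_le_left _ _)).trans_lt (half_lt_self hε₁)
  have hδ₂ : δ < ε₂ :=
    ((min_le_left _ _).trans (min_le_right _ _)).trans_lt (half_lt_self hε₂)
  have hδw₀ : δ ≤ dist w₀ v := (min_le_right _ _).trans (min_le_left _ _)
  have hδw₁ : δ ≤ dist w₁ v := (min_le_right _ _).trans (min_le_right _ _)
  have hray : ∀ t : Finset (Space d), v ∈ t → ∀ w ∈ t, w ≠ v → δ ≤ dist w v →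
      (Metric.sphere v δ ∩ simplex t).Nonempty := by
    intro t hvt w hw hwv hδw
    have hdw := dist_pos.2 hwv
    refine ⟨v + (δ / dist w v) • (w - v), ?_, ?_⟩
    · rw [Metric.mem_sphere, dist_eq_norm, add_sub_cancel_left, norm_smul, ← dist_eq_norm,
        Real.norm_of_nonneg (by positivity), div_mul_cancel₀ _ hdw.ne']
    · exact (convex_simplex t).add_smul_sub_mem (subset_simplex t hvt) (subset_simplex t hw)
        ⟨by positivity, by rw [div_le_one hdw]; exact hδw⟩
  have hrank : 1 < Module.rank ℝ (Space d) := by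
    rw [← Module.finrank_eq_rank, finrank_euclideanSpace_fin]
    exact_mod_cast hd
  have hfin := finite_cells h𝒯
  have hcl : ∀ B : Set (Finset (Space d)),
      IsClosed (⋃ t ∈ {t | t ∈ cells 𝒯 ∧ v ∈ t ∧ t ∈ B}, simplex t) := fun B =>
    (hfin.subset fun _ ht => ht.1).isClosed_biUnion fun t _ => isClosed_simplex t
  have hcover : Metric.sphere v δ ⊆ (⋃ t ∈ {t | t ∈ cells 𝒯 ∧ v ∈ t ∧ t ∈ A}, simplex t) ∪
      ⋃ t ∈ {t | t ∈ cells 𝒯 ∧ v ∈ t ∧ t ∈ Aᶜ}, simplex t := by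
    intro y hy
    rw [Metric.mem_sphere] at hy
    obtain ⟨t, ht, hyt⟩ := exists_cell_of_mem_closure h𝒯
      (subset_closure (hball (show y ∈ Metric.ball v ε₂ by rw [Metric.mem_ball, hy]; exact hδ₂)))
    have hvt : v ∈ t := mem_of_mem_simplex h₀.1 ht.1 hv₀
      (hloc t ht ⟨y, by rw [Metric.mem_ball, hy]; exact hδ₁, hyt⟩)
    by_cases htA : t ∈ A
    · exact Or.inl (Set.mem_biUnion (show t ∈ {t | _} from ⟨ht, hvt, htA⟩) hyt)
    · exact Or.inr (Set.mem_biUnion (show t ∈ {t | _} from ⟨ht, hvt, htA⟩) hyt)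
  obtain ⟨y₀, hy₀, hyt₀⟩ := hray t₀ hv₀ w₀ hw₀ hwv₀ hδw₀
  obtain ⟨y₁, hy₁, hyt₁⟩ := hray t₁ hv₁ w₁ hw₁ hwv₁ hδw₁
  obtain ⟨y, hy, hyA, hyB⟩ := isPreconnected_closed_iff.1 (isPreconnected_sphere hrank v δ) _ _
    (hcl A) (hcl Aᶜ) hcover
    ⟨y₀, hy₀, Set.mem_biUnion (show t₀ ∈ {t | _} from ⟨h₀, hv₀, hA₀⟩) hyt₀⟩
    ⟨y₁, hy₁, Set.mem_biUnion (show t₁ ∈ {t | _} from ⟨h₁, hv₁, hA₁⟩) hyt₁⟩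
  simp only [Set.mem_iUnion] at hyA hyB
  obtain ⟨t, ⟨ht, hvt, htA⟩, hyt⟩ := hyA
  obtain ⟨t', ⟨ht', hvt', htA'⟩, hyt'⟩ := hyB
  refine ⟨t, ht, t', ht', hvt, hvt', htA, htA', ?_⟩
  by_contra! hcon
  have hsub : t ∩ t' ⊆ {v} := by
    intro w hw
    rw [Finset.mem_inter] at hw
    exact Finset.mem_singleton.2 (hcon w hw.1 hw.2).symm
  have hyv : y ∈ convexHull ℝ (({v} : Finset (Space d)) : Set (Space d)) :=
    convexHull_mono (by exact_mod_cast hsub) (simplex_inter_subset ht.1 ht'.1 ⟨hyt, hyt'⟩)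
  simp only [Finset.coe_singleton, convexHull_singleton, Set.mem_singleton_iff] at hyv
  rw [hyv, Metric.mem_sphere, dist_self] at hy
  exact hδ.ne hy

/-- The constant of local quasi-uniformity. -/
def meshRatio (d : ℕ) (σ : ℝ) : ℝ := max σ 1 ^ ⌈σ ^ d⌉₊

theorem meshRatio_pos (d : ℕ) (σ : ℝ) : 0 < meshRatio d σ := by
  unfold meshRatio; positivity

/-- Cells with a common edge have sizes within a factor σ, because the edge is at least h / σ long.
Shared edges connect all cells at `v`, and there are at most σ ^ d of them, so boundedly many such
factors suffice. -/
theorem meshSize_le_of_shared_vertex (hd : 2 ≤ d) {Ω : Set (Space d)} (hΩ : IsOpen Ω)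
    (h𝒯 : IsTriangulation 𝒯 Ω) {σ : ℝ} (hσ : 0 < σ) (hT : IsShapeRegular σ 𝒯) {v : Space d}
    (hv : v ∈ Ω) {t t' : Finset (Space d)} (ht : t ∈ cells 𝒯) (hvt : v ∈ t) (ht' : t' ∈ cells 𝒯)
    (hvt' : v ∈ t') : meshSize t' ≤ meshRatio d σ * meshSize t := by
  classical
  have hh := meshSize_pos (by omega) ht
  set m : ℝ := max σ 1
  have hm : 1 ≤ m := le_max_right _ _
  have hfin : {s | s ∈ cells 𝒯 ∧ v ∈ s}.Finite := (finite_cells h𝒯).subset fun _ hs => hs.1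
  let S : Finset (Finset (Space d)) := hfin.toFinset
  have hS : ∀ s, s ∈ S ↔ s ∈ cells 𝒯 ∧ v ∈ s := fun s => by simp [S]
  let A : ℕ → Finset (Finset (Space d)) := fun n => S.filter fun s => meshSize s ≤ m ^ n * meshSize t
  have hA : ∀ n s, s ∈ A n ↔ (s ∈ cells 𝒯 ∧ v ∈ s) ∧ meshSize s ≤ m ^ n * meshSize t := by
    intro n s
    simp only [A, Finset.mem_filter, hS]
  have hmono : ∀ n, A n ⊆ A (n + 1) := by
    intro n s hs
    rw [hA] at hs ⊢
    refine ⟨hs.1, hs.2.trans ?_⟩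
    gcongr
    omega
  have htA : ∀ n, t ∈ A n := by
    intro n
    rw [hA]
    exact ⟨⟨ht, hvt⟩, le_mul_of_one_le_left hh.le (one_le_pow₀ hm)⟩
  -- As long as some cell at `v` exceeds the threshold, a shared edge yields one that enters at the
  -- next power of `m`; thus each step adds a cell until all are reached.
  have hgrow : ∀ n, A n = S ∨ n + 1 ≤ (A n).card := by
    intro n
    induction n with
    | zero => exact Or.inr (Finset.card_pos.2 ⟨t, htA 0⟩)
    | succ n ih =>
      by_cases hn : A n = S
      · left
        exact Finset.Subset.antisymm (Finset.filter_subset _ _) (hn ▸ hmono n)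
      right
      have hcard := ih.resolve_left hn
      obtain ⟨t₁, ht₁, ht₁A⟩ : ∃ t₁ ∈ S, t₁ ∉ A n := by
        by_contra! hcon
        exact hn (Finset.Subset.antisymm (Finset.filter_subset _ _) hcon)
      rw [hS] at ht₁
      obtain ⟨s, hs, s', hs', hvs, hvs', hsA, hsA', w, hw, hw', hvw⟩ := exists_shared_edge hd hΩ h𝒯 hv
        (A n : Set (Finset (Space d))) ht hvt (htA n) ht₁.1 ht₁.2 ht₁A
      have hlt : (A n).card < (A (n + 1)).card := by
        refine Finset.card_lt_card ⟨hmono n, fun hsub => hsA' (hsub ?_)⟩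
        rw [hA]
        refine ⟨⟨hs', hvs'⟩, ?_⟩
        calc meshSize s' ≤ σ * dist v w := meshSize_le_mul_dist hσ hT hs' hvs' hw' hvw
          _ ≤ m * meshSize s := by
            gcongr
            · exact le_max_left _ _
            · exact dist_le_meshSize (subset_simplex s hvs) (subset_simplex s hw)
          _ ≤ m * (m ^ n * meshSize t) := by
            gcongr
            exact ((hA n s).1 hsA).2
          _ = m ^ (n + 1) * meshSize t := by ring
      omega
  have hN : S.card ≤ ⌈σ ^ d⌉₊ := by
    have := (card_cells_le (by omega) hσ hT v S fun s hs => (hS s).1 hs).trans (Nat.le_ceil _)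
    exact_mod_cast this
  have hfull : A ⌈σ ^ d⌉₊ = S := by
    rcases hgrow ⌈σ ^ d⌉₊ with h | h
    · exact h
    · have := Finset.card_le_card (Finset.filter_subset (fun s => meshSize s ≤ m ^ ⌈σ ^ d⌉₊ *
        meshSize t) S)
      have h' : (A ⌈σ ^ d⌉₊).card ≤ S.card := this
      omega
  have := (hS t').2 ⟨ht', hvt'⟩
  rw [← hfull, hA] at this
  exact this.2

/-! ### Short paths stay in the neighbourhood of a cell -/

/-- Local Lipschitz bounds on the pieces add up although a path may enter a cell many times: from
`a`, jump directly to the last point of the piece containing `a`. That piece is not needed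
afterwards, so induction on the number of pieces applies. -/
theorem abs_sub_le_of_finite_closed_cover {ι : Type*} (F : Finset ι) (S : ι → Set ℝ)
    (hS : ∀ i ∈ F, IsClosed (S i)) (f : ℝ → ℝ) (L : ℝ)
    (hf : ∀ i ∈ F, ∀ x ∈ S i, ∀ y ∈ S i, |f x - f y| ≤ L * |x - y|) {a b : ℝ} (hab : a ≤ b)
    (hcov : Set.Icc a b ⊆ ⋃ i ∈ F, S i) : |f a - f b| ≤ L * (b - a) := by
  classical
  induction hn : F.card generalizing F a with
  | zero =>
    have := hcov (Set.left_mem_Icc.2 hab)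
    rw [Finset.card_eq_zero.1 hn] at this
    simp at this
  | succ n ih =>
    have hmem := hcov (Set.left_mem_Icc.2 hab)
    simp only [Set.mem_iUnion] at hmem
    obtain ⟨i, hi, hai⟩ := hmem
    have hcomp : IsCompact (S i ∩ Set.Icc a b) := isCompact_Icc.inter_left (hS i hi)
    obtain ⟨t, ⟨htS, htab⟩, htmax⟩ := hcomp.exists_isGreatest ⟨a, hai, Set.left_mem_Icc.2 hab⟩
    have h1 := hf i hi a hai t htS
    rw [abs_sub_comm a t, abs_of_nonneg (sub_nonneg.2 htab.1)] at h1
    rcases htab.2.eq_or_lt with rfl | htb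
    · exact h1
    have hcl : IsClosed (⋃ j ∈ F.erase i, S j) :=
      (F.erase i).finite_toSet.isClosed_biUnion fun j hj => hS j (Finset.mem_of_mem_erase hj)
    have hsub : Set.Ioc t b ⊆ ⋃ j ∈ F.erase i, S j := by
      intro x hx
      have hxm := hcov ⟨htab.1.trans hx.1.le, hx.2⟩
      simp only [Set.mem_iUnion] at hxm ⊢
      obtain ⟨j, hj, hxj⟩ := hxm
      refine ⟨j, Finset.mem_erase.2 ⟨?_, hj⟩, hxj⟩
      rintro rfl
      exact absurd (htmax ⟨hxj, htab.1.trans hx.1.le, hx.2⟩) (not_le.2 hx.1)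
    -- The point `t` itself is recovered by closedness of the remaining pieces.
    have hsub' : Set.Icc t b ⊆ ⋃ j ∈ F.erase i, S j := by
      rw [← closure_Ioc htb.ne]
      exact hcl.closure_subset_iff.2 hsub
    have h2 := ih (F.erase i) (fun j hj => hS j (Finset.mem_of_mem_erase hj))
      (fun j hj => hf j (Finset.mem_of_mem_erase hj)) htb.le hsub'
      (by rw [Finset.card_erase_of_mem hi, hn]; rfl)
    calc |f a - f b| ≤ |f a - f t| + |f t - f b| := abs_sub_le _ _ _
      _ ≤ L * (t - a) + L * (b - t) := add_le_add h1 h2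
      _ = _ := by ring

/-- The sum of the hat functions of the vertices of `t₀` is 1 on `t₀` and 0 on every cell disjoint
from its vertex set. Along the path it has Lipschitz constant at most (d + 1) σ M l / h, where M is
`meshRatio`, so a short path cannot take it from 1 to 0. -/
theorem inter_nonempty_of_short_path (hd : 2 ≤ d) {Ω : Set (Space d)} (hΩ : IsOpen Ω)
    (h𝒯 : IsTriangulation 𝒯 Ω) {σ : ℝ} (hσ : 0 < σ) (hT : IsShapeRegular σ 𝒯)
    {t₀ : Finset (Space d)} (ht₀ : t₀ ∈ cells 𝒯) (hvt₀ : ∀ v ∈ t₀, v ∈ Ω) {γ : ℝ → Space d}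
    {l : ℝ} (hl : 0 ≤ l)
    (hγ : ∀ x ∈ Set.Icc (0 : ℝ) 1, ∀ y ∈ Set.Icc (0 : ℝ) 1, dist (γ x) (γ y) ≤ l * |x - y|)
    (hγΩ : ∀ x ∈ Set.Icc (0 : ℝ) 1, γ x ∈ closure Ω) (hγ0 : γ 0 ∈ simplex t₀)
    (hlt : (d + 1) * (σ * meshRatio d σ) * l < meshSize t₀) {t : Finset (Space d)}
    (ht : t ∈ cells 𝒯) (hγ1 : γ 1 ∈ simplex t) : ∃ v ∈ t₀, v ∈ t := by
  have hh := meshSize_pos (by omega) ht₀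
  have hM := meshRatio_pos d σ
  let f : ℝ → ℝ := fun x => ∑ v ∈ t₀, baryCoord 𝒯 v (γ x)
  have hf0 : f 0 = 1 := sum_baryCoord ht₀.1 hγ0
  by_contra! hcon
  have hf1 : f 1 = 0 := Finset.sum_eq_zero fun v hv => baryCoord_eq_zero ht.1 hγ1 (hcon v hv)
  have hγc : ContinuousOn γ (Set.Icc 0 1) := by
    have : LipschitzOnWith l.toNNReal γ (Set.Icc 0 1) :=
      LipschitzOnWith.of_dist_le_mul fun x hx y hy => by
        rw [Real.coe_toNNReal _ hl]
        exact hγ x hx y hy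
    exact this.continuousOn
  have key := abs_sub_le_of_finite_closed_cover (finite_cells h𝒯).toFinset
    (fun t => Set.Icc 0 1 ∩ γ ⁻¹' simplex t)
    (fun t _ => hγc.preimage_isClosed_of_isClosed isClosed_Icc (isClosed_simplex t)) f
    ((d + 1) * (σ * meshRatio d σ) * l / meshSize t₀) ?_ zero_le_one ?_
  · rw [hf0, hf1, sub_zero, abs_one, mul_one, le_div_iff₀ hh] at key
    linarith
  · rintro s hs x ⟨hx, hxs⟩ y ⟨hy, hys⟩
    have hs' : s ∈ cells 𝒯 := by simpa using hs
    rw [← Finset.sum_sub_distrib]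
    refine (Finset.abs_sum_le_sum_abs _ _).trans ?_
    have hterm : ∀ v ∈ t₀, |baryCoord 𝒯 v (γ x) - baryCoord 𝒯 v (γ y)| ≤
        σ * meshRatio d σ * l / meshSize t₀ * |x - y| := by
      intro v hv
      -- A hat function varies only on cells containing its vertex; their size is comparable to that
      -- of `t₀` because the vertex lies in Ω.
      by_cases hvs : v ∈ s
      · have h1 := meshSize_mul_abs_baryCoord_sub_le hσ hT hs' v hxs hys
        have h2 := meshSize_le_of_shared_vertex hd hΩ h𝒯 hσ hT (hvt₀ v hv) hs' hvs ht₀ hv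
        rw [div_mul_eq_mul_div, le_div_iff₀ hh]
        calc |baryCoord 𝒯 v (γ x) - baryCoord 𝒯 v (γ y)| * meshSize t₀
            ≤ |baryCoord 𝒯 v (γ x) - baryCoord 𝒯 v (γ y)| * (meshRatio d σ * meshSize s) := by
              gcongr
          _ = meshRatio d σ * (meshSize s * |baryCoord 𝒯 v (γ x) - baryCoord 𝒯 v (γ y)|) := by ring
          _ ≤ meshRatio d σ * (σ * (l * |x - y|)) := by
              exact mul_le_mul_of_nonneg_left (h1.trans
                (mul_le_mul_of_nonneg_left (hγ x hx y hy) hσ.le)) hM.le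
          _ = _ := by ring
      · rw [baryCoord_eq_zero hs'.1 hxs hvs, baryCoord_eq_zero hs'.1 hys hvs, sub_zero, abs_zero]
        positivity
    refine (Finset.sum_le_sum hterm).trans ?_
    rw [Finset.sum_const, ht₀.2, nsmul_eq_mul]
    apply le_of_eq
    push_cast
    ring
  · intro x hx
    obtain ⟨s, hs, hxs⟩ := exists_cell_of_mem_closure h𝒯 (hγΩ x hx)
    simp only [Set.mem_iUnion]
    exact ⟨s, by simpa using hs, hx, hxs⟩

end

/-! ### The interface relative to the triangulation -/

section

variable {d : ℕ} {𝒯 : Geometry.SimplicialComplex ℝ (Space d)} {Ω : Set (Space d)}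
  {Ωs : Fin 2 → Set (Space d)}

/-! ### The interface and the cut cells -/

theorem IsBoundedDomain.isOpen (hΩ : IsBoundedDomain Ω) : IsOpen Ω := by
  rw [← hΩ.interior_closure]
  exact isOpen_interior

theorem isClosed_interface (Ωs : Fin 2 → Set (Space d)) : IsClosed (interface Ωs) :=
  isClosed_closure.inter isClosed_closure

theorem IsPartition.closure_subset (hP : IsPartition Ω Ωs) :
    closure Ω ⊆ closure (Ωs 0) ∪ closure (Ωs 1) := by
  refine closure_minimal ?_ (isClosed_closure.union isClosed_closure)
  intro x hx
  rcases hP.cover hx with (h | h) | h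
  · exact Or.inl (subset_closure h)
  · exact Or.inr (subset_closure h)
  · exact Or.inl h.1

theorem IsPartition.closure_piece_subset (hP : IsPartition Ω Ωs) (i : Fin 2) :
    closure (Ωs i) ⊆ closure Ω := closure_mono (hP.subset i)

theorem IsPartition.interface_subset (hP : IsPartition Ω Ωs) : interface Ωs ⊆ closure Ω :=
  fun _ hx => hP.closure_piece_subset 0 hx.1

/-- A cell is connected and covered by the closures of the two subdomains; a cut cell meets both. -/
theorem exists_mem_simplex_inter_interface (hP : IsPartition Ω Ωs) (h𝒯 : IsTriangulation 𝒯 Ω)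
    {t : Finset (Space d)} (ht : t ∈ cutCells 𝒯 Ωs) : (simplex t ∩ interface Ωs).Nonempty := by
  refine isPreconnected_closed_iff.1 (convex_simplex t).isPreconnected _ _ isClosed_closure
    isClosed_closure ((simplex_subset_closure h𝒯 ht.1).trans hP.closure_subset) ?_ ?_
  · exact (ht.2 0).mono (Set.inter_subset_inter_right _ subset_closure)
  · exact (ht.2 1).mono (Set.inter_subset_inter_right _ subset_closure)

theorem simplex_subset_closure_of_disjoint (hd : 1 ≤ d) {σ : ℝ} (hσ : 0 < σ)
    (hT : IsShapeRegular σ 𝒯) (h𝒯 : IsTriangulation 𝒯 Ω) {U V : Set (Space d)}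
    (hUV : closure Ω ⊆ closure U ∪ closure V) {t : Finset (Space d)} (ht : t ∈ cells 𝒯)
    (hV : ¬ (simplex t ∩ V).Nonempty) : simplex t ⊆ closure U := by
  rw [← closure_interior_simplex hd hσ hT ht]
  refine closure_minimal ?_ isClosed_closure
  intro x hx
  refine (hUV (simplex_subset_closure h𝒯 ht (interior_subset hx))).resolve_right fun hxV => hV ?_
  obtain ⟨y, hy, hyV⟩ := mem_closure_iff.1 hxV _ isOpen_interior hx
  exact ⟨y, interior_subset hy, hyV⟩

/-- If no cell at `x` were cut, each would lie in the closure of one subdomain, and both subdomains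
would occur. Two such cells that contain `x` have a common vertex, which would lie on Γ; this is
excluded since vertices are nodes. -/
theorem exists_cutCell_of_mem_interface (hd : 1 ≤ d) (hP : IsPartition Ω Ωs) {σ : ℝ} (hσ : 0 < σ)
    (hT : IsShapeRegular σ 𝒯) (h𝒯 : IsTriangulation 𝒯 Ω)
    (hvert : ∀ t ∈ cells 𝒯, ∀ v ∈ t, v ∉ interface Ωs) {x : Space d} (hx : x ∈ interface Ωs) :
    ∃ t ∈ cutCells 𝒯 Ωs, x ∈ simplex t := by
  classical
  by_contra! hcon
  obtain ⟨ε, hε, hloc⟩ := exists_ball_inter_simplex h𝒯 x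
  have hnear : ∀ i, x ∈ closure (Ωs i) →
      ∃ t ∈ cells 𝒯, x ∈ simplex t ∧ (simplex t ∩ Ωs i).Nonempty := by
    intro i hxi
    obtain ⟨y, hy, hyi⟩ := mem_closure_iff.1 hxi _ Metric.isOpen_ball (Metric.mem_ball_self hε)
    obtain ⟨t, ht, hyt⟩ := exists_cell_of_mem_closure h𝒯 (subset_closure (hP.subset i hyi))
    exact ⟨t, ht, hloc t ht ⟨y, hy, hyt⟩, y, hyt, hyi⟩
  obtain ⟨t₀, ht₀, hx₀, hne₀⟩ := hnear 0 hx.1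
  obtain ⟨t₁, ht₁, hx₁, hne₁⟩ := hnear 1 hx.2
  have h₀ : simplex t₀ ⊆ closure (Ωs 0) :=
    simplex_subset_closure_of_disjoint hd hσ hT h𝒯 hP.closure_subset ht₀ fun h =>
      hcon t₀ ⟨ht₀, Fin.forall_fin_two.2 ⟨hne₀, h⟩⟩ hx₀
  have h₁ : simplex t₁ ⊆ closure (Ωs 1) :=
    simplex_subset_closure_of_disjoint hd hσ hT h𝒯
      (hP.closure_subset.trans (Set.union_comm _ _).subset) ht₁ fun h =>
      hcon t₁ ⟨ht₁, Fin.forall_fin_two.2 ⟨h, hne₁⟩⟩ hx₁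
  have hxi : x ∈ simplex (t₀ ∩ t₁) := simplex_inter_subset ht₀.1 ht₁.1 ⟨hx₀, hx₁⟩
  have hne : ((t₀ ∩ t₁ : Finset (Space d)) : Set (Space d)).Nonempty :=
    convexHull_nonempty_iff.1 ⟨x, hxi⟩
  obtain ⟨v, hv⟩ := hne
  rw [Finset.mem_coe, Finset.mem_inter] at hv
  exact hvert t₀ ht₀ v hv.1 ⟨h₀ (subset_simplex t₀ hv.1), h₁ (subset_simplex t₁ hv.2)⟩

theorem card_neighbours_le (hd : 1 ≤ d) {σ : ℝ} (hσ : 0 < σ) (hT : IsShapeRegular σ 𝒯)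
    {t₀ : Finset (Space d)} (ht₀ : t₀ ∈ cells 𝒯) (F : Finset (Finset (Space d)))
    (hF : ∀ t ∈ F, t ∈ cells 𝒯 ∧ ∃ v ∈ t₀, v ∈ t) : (F.card : ℝ) ≤ (d + 1) * σ ^ d := by
  classical
  have hsub : F ⊆ t₀.biUnion fun v => F.filter fun t => v ∈ t := by
    intro t ht
    obtain ⟨v, hv, hvt⟩ := (hF t ht).2
    exact Finset.mem_biUnion.2 ⟨v, hv, Finset.mem_filter.2 ⟨ht, hvt⟩⟩
  have h1 : (F.card : ℝ) ≤ ∑ v ∈ t₀, ((F.filter fun t => v ∈ t).card : ℝ) := by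
    exact_mod_cast (Finset.card_le_card hsub).trans Finset.card_biUnion_le
  refine h1.trans ((Finset.sum_le_card_nsmul _ _ (σ ^ d) fun v _ => ?_).trans ?_)
  · refine card_cells_le hd hσ hT v _ fun t ht => ?_
    rw [Finset.mem_filter] at ht
    exact ⟨(hF t ht.1).1, ht.2⟩
  · rw [ht₀.2, nsmul_eq_mul]
    push_cast
    exact le_rfl

/-! ### The measure of the interface in a cell -/

theorem euclideanHausdorffMeasure_image_le {X Y : Type*} [MetricSpace X] [MeasurableSpace X]
    [BorelSpace X] [MetricSpace Y] [MeasurableSpace Y] [BorelSpace Y] (n : ℕ) {K : NNReal}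
    {f : X → Y} {s : Set X} (hf : LipschitzOnWith K f s) :
    μHE[n] (f '' s) ≤ (K : ENNReal) ^ n * μHE[n] s := by
  have h := hf.hausdorffMeasure_image_le (d := (n : ℝ)) (Nat.cast_nonneg n)
  rw [ENNReal.rpow_natCast] at h
  rw [Measure.euclideanHausdorffMeasure_def, Measure.euclideanHausdorffMeasure_def,
    Measure.smul_apply, Measure.smul_apply, mul_smul_comm]
  gcongr

/-- Within one parametrized patch, the part of Γ in the cell is the image of a parameter set of
radius K h. The cell may be larger than a patch, or meet several sheets of Γ, so Ω is covered by
balls of radius r / (2K); their number depends only on Ω, K, r. -/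
theorem exists_interface_measure_le (hΩ : IsBoundedDomain Ω) {K r : ℝ} (hK : 0 < K) (hr : 0 < r) :
    ∃ C : ℝ, 0 < C ∧ ∀ Ωs : Fin 2 → Set (Space d), IsPartition Ω Ωs →
      IsRegularHypersurface K r (interface Ωs) → ∀ t : Finset (Space d),
      μHE[d - 1] (simplex t ∩ interface Ωs) ≤ ENNReal.ofReal (C * meshSize t ^ (d - 1)) := by
  obtain ⟨F, hFfin, hF⟩ := Metric.totallyBounded_iff.1
    (Metric.isCompact_of_isClosed_isBounded isClosed_closure
      hΩ.isBounded.closure).totallyBounded (r / K / 2) (by positivity)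
  obtain ⟨F, rfl⟩ := hFfin.exists_finset_coe
  let ω : ℝ := (volume (Metric.ball (0 : Space (d - 1)) 1)).toReal
  have hω : volume (Metric.ball (0 : Space (d - 1)) 1) = ENNReal.ofReal ω :=
    (ENNReal.ofReal_toReal measure_ball_lt_top.ne).symm
  have hω0 : 0 ≤ ω := ENNReal.toReal_nonneg
  -- One factor K ^ (d - 1) comes from the Lipschitz map, the other from the radius K h; the added 1
  -- makes positivity immediate.
  refine ⟨F.card * (K ^ (d - 1) * (K ^ (d - 1) * ω)) + 1,
    add_pos_of_nonneg_of_pos (mul_nonneg (Nat.cast_nonneg _) (by positivity)) one_pos, ?_⟩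
  intro Ωs hP hreg t
  set h := meshSize t with hh
  have hh0 : 0 ≤ h := Metric.diam_nonneg
  have hpatch : ∀ y : Space d, μHE[d - 1] (simplex t ∩ interface Ωs ∩ Metric.ball y (r / K / 2)) ≤
      ENNReal.ofReal (K ^ (d - 1) * ((K * h) ^ (d - 1) * ω)) := by
    intro y
    rcases Set.eq_empty_or_nonempty (simplex t ∩ interface Ωs ∩ Metric.ball y (r / K / 2)) with
      he | ⟨x, ⟨hxt, hxΓ⟩, hxy⟩
    · rw [he]; simp
    obtain ⟨ψ, y₀, hy₀, hψ, hLip, -, hcov⟩ := hreg x hxΓ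
    set A := halfSpace d ∩ Metric.ball y₀ r ∩ Metric.closedBall y₀ (K * h)
    have hsub : simplex t ∩ interface Ωs ∩ Metric.ball y (r / K / 2) ⊆ ψ '' A := by
      rintro x' ⟨⟨hxt', hxΓ'⟩, hxy'⟩
      have hball : x' ∈ Metric.ball x (r / K) := by
        rw [Metric.mem_ball] at *
        calc dist x' x ≤ dist x' y + dist x y := dist_triangle_right _ _ _
          _ < r / K / 2 + r / K / 2 := add_lt_add hxy' hxy
          _ = r / K := add_halves _
      obtain ⟨u, hu, rfl⟩ := hcov ⟨hxΓ', hball⟩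
      refine ⟨u, ⟨hu, ?_⟩, rfl⟩
      rw [Metric.mem_closedBall]
      refine (hLip u hu y₀ ⟨hy₀, Metric.mem_ball_self hr⟩).2.trans ?_
      rw [hψ]
      gcongr
      exact dist_le_meshSize hxt' hxt
    have hLip' : LipschitzOnWith K.toNNReal ψ A :=
      LipschitzOnWith.of_dist_le_mul fun u hu u' hu' => by
        rw [Real.coe_toNNReal _ hK.le]
        exact (hLip u hu.1 u' hu'.1).1
    calc μHE[d - 1] (simplex t ∩ interface Ωs ∩ Metric.ball y (r / K / 2))
        ≤ μHE[d - 1] (ψ '' A) := measure_mono hsub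
      _ ≤ (K.toNNReal : ENNReal) ^ (d - 1) * μHE[d - 1] A :=
          euclideanHausdorffMeasure_image_le _ hLip'
      _ ≤ (K.toNNReal : ENNReal) ^ (d - 1) * volume (Metric.closedBall y₀ (K * h)) := by
          rw [EuclideanSpace.euclideanHausdorffMeasure_eq_volume]
          gcongr
          exact Set.inter_subset_right
      _ = ENNReal.ofReal (K ^ (d - 1) * ((K * h) ^ (d - 1) * ω)) := by
          rw [Measure.addHaar_closedBall _ _ (by positivity), finrank_euclideanSpace_fin, hω,
            ENNReal.ofReal_mul (by positivity), ENNReal.ofReal_mul (by positivity),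
            ENNReal.ofReal_pow hK.le]
          rfl
  have hsub : simplex t ∩ interface Ωs ⊆
      ⋃ y ∈ F, simplex t ∩ interface Ωs ∩ Metric.ball y (r / K / 2) := by
    intro x hx
    have := hF (hP.interface_subset hx.2)
    simp only [Set.mem_iUnion] at this ⊢
    obtain ⟨y, hy, hxy⟩ := this
    exact ⟨y, hy, hx, hxy⟩
  calc μHE[d - 1] (simplex t ∩ interface Ωs)
      ≤ ∑ y ∈ F, μHE[d - 1] (simplex t ∩ interface Ωs ∩ Metric.ball y (r / K / 2)) :=
        (measure_mono hsub).trans (measure_biUnion_finset_le _ _)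
    _ ≤ ∑ y ∈ F, ENNReal.ofReal (K ^ (d - 1) * ((K * h) ^ (d - 1) * ω)) :=
        Finset.sum_le_sum fun y _ => hpatch y
    _ = ENNReal.ofReal (F.card * (K ^ (d - 1) * ((K * h) ^ (d - 1) * ω))) := by
        rw [Finset.sum_const, nsmul_eq_mul, ENNReal.ofReal_mul (Nat.cast_nonneg _),
          ENNReal.ofReal_natCast]
    _ ≤ _ := by
        refine ENNReal.ofReal_le_ofReal ?_
        rw [mul_pow, add_mul, one_mul]
        have : 0 ≤ h ^ (d - 1) := by positivity
        linarith [show F.card * (K ^ (d - 1) * (K ^ (d - 1) * h ^ (d - 1) * ω)) =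
          F.card * (K ^ (d - 1) * (K ^ (d - 1) * ω)) * h ^ (d - 1) by ring]

theorem convex_halfSpace (d : ℕ) : Convex ℝ (halfSpace d) := by
  intro x hx y hy a b ha hb _ i hi
  have h1 := hx i hi
  have h2 := hy i hi
  simp only [PiLp.add_apply, PiLp.smul_apply, smul_eq_mul]
  positivity

theorem volume_halfSpace_inter_ball_ge (hd : 2 ≤ d) {y₀ : Space (d - 1)} (hy₀ : y₀ ∈ halfSpace d)
    {ρ : ℝ} (hρ : 0 < ρ) :
    ENNReal.ofReal ((ρ / 2) ^ (d - 1)) * volume (Metric.ball (0 : Space (d - 1)) 1) ≤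
      volume (halfSpace d ∩ Metric.ball y₀ ρ) := by
  -- Moving the centre by ρ / 2 into the half space yields a full ball of radius ρ / 2 inside the
  -- half ball.
  let e : Space (d - 1) := EuclideanSpace.single (⟨0, by omega⟩ : Fin (d - 1)) (1 : ℝ)
  have he : ‖e‖ = 1 := by simp [e]
  have hvol := Measure.addHaar_ball_of_pos (volume : Measure (Space (d - 1))) (y₀ + (ρ / 2) • e)
    (show (0 : ℝ) < ρ / 2 by positivity)
  rw [finrank_euclideanSpace_fin] at hvol
  rw [← hvol]
  refine measure_mono fun y hy => ⟨?_, ?_⟩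
  · intro i hi
    have hi' : i = ⟨0, by omega⟩ := Fin.ext hi
    have h1 := PiLp.norm_apply_le (y - (y₀ + (ρ / 2) • e)) i
    rw [Metric.mem_ball, dist_eq_norm] at hy
    have h2 := hy₀ i hi
    have h3 : e i = 1 := by rw [hi']; simp [e]
    simp only [PiLp.sub_apply, PiLp.add_apply, PiLp.smul_apply, smul_eq_mul, h3, mul_one,
      Real.norm_eq_abs] at h1
    have h4 := (abs_le.1 (h1.trans hy.le)).1
    linarith
  · rw [Metric.mem_ball] at hy ⊢
    calc dist y y₀ ≤ dist y (y₀ + (ρ / 2) • e) + dist (y₀ + (ρ / 2) • e) y₀ := dist_triangle _ _ _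
      _ < ρ / 2 + ρ / 2 := by
        refine add_lt_add_of_lt_of_le hy ?_
        rw [dist_eq_norm, add_sub_cancel_left, norm_smul, he, mul_one,
          Real.norm_of_nonneg (by positivity)]
      _ = ρ := add_halves ρ

theorem meshSize_le_diam (hΩ : IsBoundedDomain Ω) (h𝒯 : IsTriangulation 𝒯 Ω)
    {t : Finset (Space d)} (ht : t ∈ cells 𝒯) : meshSize t ≤ Metric.diam (closure Ω) :=
  Metric.diam_mono (simplex_subset_closure h𝒯 ht) hΩ.isBounded.closure

/-- The segment from `y₀` to `y` stays in the convex half ball, and `ψ` maps it to a path in Γ with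
Lipschitz constant below K ρ. Its endpoint lies in some cut cell, and the smallness of ρ forces that
cell to touch `t₀`. -/
theorem exists_neighbour_of_mem_patch (hd : 2 ≤ d) (hΩ : IsBoundedDomain Ω)
    (hP : IsPartition Ω Ωs) {σ : ℝ} (hσ : 0 < σ) (hT : IsShapeRegular σ 𝒯)
    (h𝒯 : IsTriangulation 𝒯 Ω) (hvert : ∀ t ∈ cells 𝒯, ∀ v ∈ t, v ∉ interface Ωs)
    {K r ρ : ℝ} (hK : 0 < K) {ψ : Space (d - 1) → Space d} {y₀ : Space (d - 1)}
    (hy₀ : y₀ ∈ halfSpace d) (hρ : 0 < ρ) (hρr : ρ ≤ r)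
    (hLip : ∀ y ∈ halfSpace d ∩ Metric.ball y₀ r, ∀ z ∈ halfSpace d ∩ Metric.ball y₀ r,
      dist (ψ y) (ψ z) ≤ K * dist y z)
    (hΓ : ψ '' (halfSpace d ∩ Metric.ball y₀ r) ⊆ interface Ωs)
    {t₀ : Finset (Space d)} (ht₀ : t₀ ∈ cells 𝒯) (hv₀ : ∀ v ∈ t₀, v ∈ Ω) (hx : ψ y₀ ∈ simplex t₀)
    (hsmall : (d + 1) * (σ * meshRatio d σ) * (K * ρ) < meshSize t₀)
    {y : Space (d - 1)} (hy : y ∈ halfSpace d ∩ Metric.ball y₀ ρ) :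
    ∃ t ∈ cutCells 𝒯 Ωs, (∃ v ∈ t₀, v ∈ t) ∧ ψ y ∈ simplex t := by
  have hM := meshRatio_pos d σ
  have hball : Metric.ball y₀ ρ ⊆ Metric.ball y₀ r := Metric.ball_subset_ball hρr
  have hconv : Convex ℝ (halfSpace d ∩ Metric.ball y₀ r) :=
    (convex_halfSpace d).inter (convex_ball _ _)
  have hy₀' : y₀ ∈ halfSpace d ∩ Metric.ball y₀ r :=
    ⟨hy₀, Metric.mem_ball_self (hρ.trans_le hρr)⟩
  have hy' : y ∈ halfSpace d ∩ Metric.ball y₀ r := ⟨hy.1, hball hy.2⟩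
  have hseg : ∀ x ∈ Set.Icc (0 : ℝ) 1, y₀ + x • (y - y₀) ∈ halfSpace d ∩ Metric.ball y₀ r :=
    fun x hx => hconv.add_smul_sub_mem hy₀' hy' hx
  obtain ⟨t, ht, hyt⟩ := exists_cutCell_of_mem_interface (by omega) hP hσ hT h𝒯 hvert
    (hΓ ⟨y, hy', rfl⟩)
  refine ⟨t, ht, ?_, hyt⟩
  have hdy : dist y y₀ < ρ := hy.2
  refine inter_nonempty_of_short_path hd hΩ.isOpen h𝒯 hσ hT ht₀ hv₀
    (γ := fun x => ψ (y₀ + x • (y - y₀))) (l := K * dist y y₀) (by positivity) ?_ ?_ ?_ ?_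
    ht.1 ?_
  · intro x hx x' hx'
    refine (hLip _ (hseg x hx) _ (hseg x' hx')).trans_eq ?_
    rw [dist_add_left, dist_eq_norm (x • (y - y₀)), ← sub_smul, norm_smul, ← dist_eq_norm y,
      Real.norm_eq_abs]
    ring
  · intro x hx
    exact hP.interface_subset (hΓ ⟨_, hseg x hx, rfl⟩)
  · simpa using hx
  · refine lt_of_le_of_lt ?_ hsmall
    gcongr
  · simpa using hyt

/-- Pigeonhole: a patch of Γ of radius proportional to h has measure of order h ^ (d - 1) and is
covered by at most (d + 1) σ ^ d neighbours of `t₀`. The cell found need not be `t₀`, whose own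
share of Γ may be arbitrarily small. -/
theorem exists_interface_measure_ge (hd : 2 ≤ d) (hΩ : IsBoundedDomain Ω) {σ K r : ℝ}
    (hσ : 0 < σ) (hK : 0 < K) (hr : 0 < r) :
    ∃ c : ℝ, 0 < c ∧ ∀ Ωs : Fin 2 → Set (Space d), IsPartition Ω Ωs →
      IsRegularHypersurface K r (interface Ωs) →
      ∀ 𝒯 : Geometry.SimplicialComplex ℝ (Space d), IsTriangulation 𝒯 Ω → IsShapeRegular σ 𝒯 →
      (∀ t ∈ cells 𝒯, ∀ v ∈ t, v ∉ interface Ωs) → ∀ t₀ ∈ cutCells 𝒯 Ωs, (∀ v ∈ t₀, v ∈ Ω) →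
      ∃ t ∈ cutCells 𝒯 Ωs, (∃ v ∈ t₀, v ∈ t) ∧
        ENNReal.ofReal (c * meshSize t₀ ^ (d - 1)) ≤ μHE[d - 1] (simplex t ∩ interface Ωs) := by
  classical
  have hM := meshRatio_pos d σ
  set D := Metric.diam (closure Ω) + 1 with hD
  have hD0 : 0 < D := by positivity
  -- The first entry gives ρ ≤ r, since D exceeds every mesh size; the second makes the paths in the
  -- patch short enough.
  let c₁ : ℝ := min (r / D) (1 / (2 * ((d + 1) * (σ * meshRatio d σ) * K)))
  have hc₁ : 0 < c₁ := by simp only [c₁, lt_min_iff]; constructor <;> positivity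
  let ω : ℝ := (volume (Metric.ball (0 : Space (d - 1)) 1)).toReal
  have hωt : volume (Metric.ball (0 : Space (d - 1)) 1) ≠ ⊤ := measure_ball_lt_top.ne
  have hω : volume (Metric.ball (0 : Space (d - 1)) 1) = ENNReal.ofReal ω :=
    (ENNReal.ofReal_toReal hωt).symm
  have hω0 : 0 < ω := ENNReal.toReal_pos (Metric.measure_ball_pos _ _ one_pos).ne' hωt
  let N : ℝ := (d + 1) * σ ^ d
  have hN : 0 < N := by positivity
  -- Half the pigeonhole value: if all neighbours stayed below c h ^ (d - 1), the patch would have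
  -- at most half its guaranteed measure.
  let c : ℝ := (c₁ / 2) ^ (d - 1) * ω / (2 * (K ^ (d - 1) * N))
  have hc : 0 < c := by positivity
  refine ⟨c, hc, ?_⟩
  intro Ωs hP hreg 𝒯 h𝒯 hT hvert t₀ ht₀ hv₀
  have hh := meshSize_pos (by omega) ht₀.1
  set h := meshSize t₀ with hhdef
  obtain ⟨x, hxt, hxΓ⟩ := exists_mem_simplex_inter_interface hP h𝒯 ht₀
  obtain ⟨ψ, y₀, hy₀, hψ, hLip, hΓ, -⟩ := hreg x hxΓ
  set ρ := c₁ * h with hρdef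
  have hρ : 0 < ρ := by positivity
  have hρr : ρ ≤ r := by
    calc ρ ≤ r / D * D := by
          rw [hρdef]
          gcongr
          · exact min_le_left _ _
          · have := meshSize_le_diam hΩ h𝒯 ht₀.1
            rw [hD]; linarith
      _ = r := by field_simp
  have hsmall : (d + 1) * (σ * meshRatio d σ) * (K * ρ) < h := by
    have h1 : c₁ ≤ 1 / (2 * ((d + 1) * (σ * meshRatio d σ) * K)) := min_le_right _ _
    calc (d + 1) * (σ * meshRatio d σ) * (K * ρ)
        = (d + 1) * (σ * meshRatio d σ) * K * c₁ * h := by rw [hρdef]; ring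
      _ ≤ (d + 1) * (σ * meshRatio d σ) * K *
          (1 / (2 * ((d + 1) * (σ * meshRatio d σ) * K))) * h := by gcongr
      _ = h / 2 := by field_simp
      _ < h := half_lt_self hh
  set A := halfSpace d ∩ Metric.ball y₀ ρ with hA
  have hAsub : A ⊆ halfSpace d ∩ Metric.ball y₀ r :=
    Set.inter_subset_inter_right _ (Metric.ball_subset_ball hρr)
  have hfin : {t | t ∈ cutCells 𝒯 Ωs ∧ ∃ v ∈ t₀, v ∈ t}.Finite :=
    (finite_cells h𝒯).subset fun _ ht => ht.1.1
  let W := hfin.toFinset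
  have hW : ∀ t, t ∈ W ↔ t ∈ cutCells 𝒯 Ωs ∧ ∃ v ∈ t₀, v ∈ t := fun t => by simp [W]
  by_contra! hcon
  have hcover : ψ '' A ⊆ ⋃ t ∈ W, simplex t ∩ interface Ωs := by
    rintro _ ⟨y, hy, rfl⟩
    obtain ⟨t, ht, hvt, hyt⟩ := exists_neighbour_of_mem_patch hd hΩ hP hσ hT h𝒯 hvert hK hy₀ hρ hρr
      (fun y hy z hz => (hLip y hy z hz).1) hΓ ht₀.1 hv₀ (by rw [hψ]; exact hxt) hsmall hy
    exact Set.mem_biUnion ((hW t).2 ⟨ht, hvt⟩) ⟨hyt, hΓ ⟨y, hAsub hy, rfl⟩⟩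
  have hinj : Set.InjOn ψ A := by
    intro y hy z hz hyz
    have := (hLip y (hAsub hy) z (hAsub hz)).2
    rw [hyz, dist_self, mul_zero] at this
    exact dist_le_zero.1 this
  -- The lower measure bound comes from the inverse parametrization, which carries the patch back to
  -- the half ball.
  have hback : LipschitzOnWith K.toNNReal (Function.invFunOn ψ A) (ψ '' A) := by
    refine LipschitzOnWith.of_dist_le_mul ?_
    rintro _ ⟨y, hy, rfl⟩ _ ⟨z, hz, rfl⟩
    rw [Real.coe_toNNReal _ hK.le, hinj.leftInvOn_invFunOn hy, hinj.leftInvOn_invFunOn hz]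
    exact (hLip y (hAsub hy) z (hAsub hz)).2
  have hAvol : volume A ≤ (K.toNNReal : ENNReal) ^ (d - 1) * μHE[d - 1] (ψ '' A) := by
    have h1 := euclideanHausdorffMeasure_image_le (d - 1) hback
    rwa [hinj.leftInvOn_invFunOn.image_image,
      EuclideanSpace.euclideanHausdorffMeasure_eq_volume] at h1
  have hcard : (W.card : ℝ) ≤ N := card_neighbours_le (by omega) hσ hT ht₀.1 W fun t ht =>
    ⟨((hW t).1 ht).1.1, ((hW t).1 ht).2⟩
  have hupper : μHE[d - 1] (ψ '' A) ≤ ENNReal.ofReal (N * (c * h ^ (d - 1))) :=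
    calc μHE[d - 1] (ψ '' A) ≤ ∑ t ∈ W, μHE[d - 1] (simplex t ∩ interface Ωs) :=
          (measure_mono hcover).trans (measure_biUnion_finset_le _ _)
      _ ≤ ∑ t ∈ W, ENNReal.ofReal (c * h ^ (d - 1)) :=
          Finset.sum_le_sum fun t ht => (hcon t ((hW t).1 ht).1 ((hW t).1 ht).2).le
      _ = ENNReal.ofReal (W.card * (c * h ^ (d - 1))) := by
          rw [Finset.sum_const, nsmul_eq_mul, ENNReal.ofReal_mul (Nat.cast_nonneg _),
            ENNReal.ofReal_natCast]
      _ ≤ _ := ENNReal.ofReal_le_ofReal (by gcongr)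
  have hfinal : ENNReal.ofReal ((ρ / 2) ^ (d - 1) * ω) ≤
      ENNReal.ofReal (K ^ (d - 1) * (N * (c * h ^ (d - 1)))) := by
    rw [ENNReal.ofReal_mul (by positivity), ← hω, ENNReal.ofReal_mul (by positivity),
      ENNReal.ofReal_pow hK.le]
    exact (volume_halfSpace_inter_ball_ge hd hy₀ hρ).trans
      (hAvol.trans (mul_le_mul_right hupper _))
  rw [ENNReal.ofReal_le_ofReal_iff (by positivity)] at hfinal
  have heq : K ^ (d - 1) * (N * (c * h ^ (d - 1))) = (ρ / 2) ^ (d - 1) * ω / 2 := by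
    simp only [c, hρdef]
    rw [show c₁ * h / 2 = c₁ / 2 * h by ring, mul_pow (c₁ / 2) h]
    field_simp
  rw [heq] at hfinal
  have : 0 < (ρ / 2) ^ (d - 1) * ω := by positivity
  linarith

end

/-! ### Lagrange functions and projections on a cell -/

section

variable {d : ℕ} {𝒯 : Geometry.SimplicialComplex ℝ (Space d)} {Ω : Set (Space d)}
  {Ωs : Fin 2 → Set (Space d)} {k : ℕ}

/-! ### Finite element functions on a cell -/

theorem nodalBasis_eq_zero {t : Finset (Space d)} (ht : t ∈ cells 𝒯) {a : Space d →₀ ℕ}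
    (ha : ¬ a.support ⊆ t) {y : Space d} (hy : y ∈ simplex t) : nodalBasis 𝒯 k a y = 0 := by
  obtain ⟨v, hv, hvt⟩ := Finset.not_subset.1 ha
  -- The factor m = 0 is a multiple of the barycentric coordinate of `v`, which vanishes on the
  -- cell.
  refine Finset.prod_eq_zero hv (Finset.prod_eq_zero (i := 0) ?_ ?_)
  · exact Finset.mem_range.2 (Nat.pos_of_ne_zero (Finsupp.mem_support_iff.1 hv))
  · rw [baryCoord_eq_zero ht.1 hy hvt]
    simp

theorem exists_polySpace_eq_nodalBasis {t : Finset (Space d)} (ht : t ∈ cells 𝒯)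
    {a : Space d →₀ ℕ} (ha : IsNode 𝒯 k a) :
    ∃ p ∈ polySpace d k, ∀ y ∈ simplex t, nodalBasis 𝒯 k a y = p y := by
  choose l hl using fun v => exists_affineMap_eq_baryCoord ht v
  let q : Space d → ℕ → Space d → ℝ := fun v m y => (k * l v y - m) / ((a v : ℝ) - m)
  have hq : ∀ v m, q v m ∈ polySpace d 1 := by
    intro v m
    have h1 : q v m = ((a v : ℝ) - m)⁻¹ • ((k : ℝ) • (l v : Space d → ℝ) - fun _ => (m : ℝ)) := by
      ext y
      simp [q, div_eq_inv_mul]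
    rw [polySpace, pow_one, h1]
    exact Submodule.smul_mem _ _ (sub_mem (Submodule.smul_mem _ _ (affineMap_mem_affineSpace _))
      (const_mem_affineSpace _))
  refine ⟨∏ v ∈ a.support, ∏ m ∈ Finset.range (a v), q v m, ?_, ?_⟩
  · rw [← ha.2]
    refine prod_mem_polySpace _ _ _ fun v _ => ?_
    simpa using prod_mem_polySpace (Finset.range (a v)) (fun _ => 1) (q v) fun m _ => hq v m
  · intro y hy
    simp only [nodalBasis, Finset.prod_apply, q, hl _ y hy]

/-- There are k factors in total; each numerator is at most k in absolute value and each denominator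
at least 1. -/
theorem abs_nodalBasis_le {t : Finset (Space d)} (ht : t ∈ cells 𝒯) {a : Space d →₀ ℕ}
    (ha : IsNode 𝒯 k a) {y : Space d} (hy : y ∈ simplex t) :
    |nodalBasis 𝒯 k a y| ≤ (k : ℝ) ^ k := by
  have hle : ∀ v ∈ a.support, a v ≤ k := fun v hv => by
    rw [← ha.2]; exact Finset.single_le_sum (fun _ _ => Nat.zero_le _) hv
  calc |nodalBasis 𝒯 k a y| ≤ ∏ v ∈ a.support, (k : ℝ) ^ a v := by
        rw [nodalBasis, Finset.abs_prod]
        refine Finset.prod_le_prod (fun v _ => abs_nonneg _) fun v hv => ?_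
        rw [Finset.abs_prod, ← Finset.card_range (a v), ← Finset.prod_const, Finset.card_range]
        refine Finset.prod_le_prod (fun m _ => abs_nonneg _) fun m hm => ?_
        have hm' : (m : ℝ) + 1 ≤ a v := by exact_mod_cast Finset.mem_range.1 hm
        have hv' : (a v : ℝ) ≤ k := by exact_mod_cast hle v hv
        have hm0 : (0 : ℝ) ≤ m := Nat.cast_nonneg m
        have h0 := baryCoord_nonneg ht.1 hy v
        have h1 := baryCoord_le_one ht.1 hy v
        have hk0 : (0 : ℝ) ≤ k := Nat.cast_nonneg k
        rw [abs_div, div_le_iff₀ (by rw [abs_pos]; linarith), abs_of_nonneg (a := (a v : ℝ) - m)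
          (by linarith)]
        have h2 : |(k : ℝ) * baryCoord 𝒯 v y - m| ≤ k := by
          have h3 : (k : ℝ) * baryCoord 𝒯 v y ≤ k := mul_le_of_le_one_right hk0 h1
          have h4 : 0 ≤ (k : ℝ) * baryCoord 𝒯 v y := by positivity
          rw [abs_le]
          constructor <;> linarith
        exact h2.trans (le_mul_of_one_le_right hk0 (by linarith))
    _ = (k : ℝ) ^ k := by rw [Finset.prod_pow_eq_pow_sum, ha.2]

theorem nodePos_mem_simplex (hk : 1 ≤ k) {a : Space d →₀ ℕ} (ha : IsNode 𝒯 k a)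
    {t : Finset (Space d)} (hat : a.support ⊆ t) : nodePos k a ∈ simplex t := by
  have hk' : (k : ℝ) ≠ 0 := by positivity
  refine convexHull_mono (show ((a.support : Finset (Space d)) : Set (Space d)) ⊆ t from
    by exact_mod_cast hat) ?_
  refine Finset.mem_convexHull'.2 ⟨fun v => (a v : ℝ) / k, fun v _ => by positivity, ?_, rfl⟩
  rw [← Finset.sum_div, ← Nat.cast_sum, ha.2, div_self hk']

theorem isNode_single (hk : 1 ≤ k) {t : Finset (Space d)} (ht : t ∈ 𝒯.faces) {v : Space d}
    (hv : v ∈ t) : IsNode 𝒯 k (Finsupp.single v k) := by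
  have hs : (Finsupp.single v k).support = {v} := Finsupp.support_single v (by omega)
  refine ⟨?_, ?_⟩
  · rw [hs]
    exact 𝒯.down_closed ht (Finset.singleton_subset_iff.2 hv) (by simp)
  · rw [hs]; simp

theorem nodePos_single (hk : 1 ≤ k) (v : Space d) : nodePos k (Finsupp.single v k) = v := by
  have hs : (Finsupp.single v k).support = {v} := Finsupp.support_single v (by omega)
  have hk' : (k : ℝ) ≠ 0 := by positivity
  simp [nodePos, hs, hk']

theorem subset_cutDomain {t : Finset (Space d)} (ht : t ∈ cutCells 𝒯 Ωs) :
    simplex t ⊆ cutDomain 𝒯 Ωs := fun _ hy => Set.mem_biUnion ht hy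

theorem exists_polySpace_eq {u : Space d → ℝ} (hu : u ∈ cutSpace 𝒯 k Ω Ωs)
    {t : Finset (Space d)} (ht : t ∈ cutCells 𝒯 Ωs) :
    ∃ p ∈ polySpace d k, ∀ y ∈ simplex t, u y = p y := by
  refine Submodule.span_induction
    (p := fun u _ => ∃ p ∈ polySpace d k, ∀ y ∈ simplex t, u y = p y) ?_ ?_ ?_ ?_ hu
  · rintro _ ⟨a, ha, rfl⟩
    obtain ⟨p, hp, hpe⟩ := exists_polySpace_eq_nodalBasis ht.1 ha.1.1
    refine ⟨p, hp, fun y hy => ?_⟩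
    rw [cutBasis, Set.indicator_of_mem (subset_cutDomain ht hy), hpe y hy]
  · exact ⟨0, zero_mem _, fun y _ => rfl⟩
  · rintro f g _ _ ⟨p, hp, hpe⟩ ⟨q, hq, hqe⟩
    exact ⟨p + q, add_mem hp hq, fun y hy => by rw [Pi.add_apply, Pi.add_apply, hpe y hy, hqe y hy]⟩
  · rintro c f _ ⟨p, hp, hpe⟩
    exact ⟨c • p, Submodule.smul_mem _ _ hp, fun y hy => by
      rw [Pi.smul_apply, Pi.smul_apply, hpe y hy]⟩

theorem eq_zero_of_notMem_cutDomain {u : Space d → ℝ} (hu : u ∈ cutSpace 𝒯 k Ω Ωs) {y : Space d}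
    (hy : y ∉ cutDomain 𝒯 Ωs) : u y = 0 := by
  refine Submodule.span_induction (p := fun u _ => u y = 0) ?_ rfl ?_ ?_ hu
  · rintro _ ⟨a, -, rfl⟩
    exact Set.indicator_of_notMem hy _
  · intro f g _ _ hf hg
    rw [Pi.add_apply, hf, hg, add_zero]
  · intro c f _ hf
    rw [Pi.smul_apply, hf, smul_zero]

theorem exists_sum_eq {u : Space d → ℝ} (hu : u ∈ cutSpace 𝒯 k Ω Ωs) :
    ∃ (s : Finset (Space d →₀ ℕ)) (β : (Space d →₀ ℕ) → ℝ), (∀ a ∈ s, a ∈ cutNodes 𝒯 k Ω Ωs) ∧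
      u = ∑ a ∈ s, β a • cutBasis 𝒯 k Ωs a := by
  obtain ⟨l, hl, rfl⟩ := (Finsupp.mem_span_image_iff_linearCombination ℝ).1 hu
  refine ⟨l.support, l, fun a ha => hl ha, ?_⟩
  rw [Finsupp.linearCombination_apply, Finsupp.sum]

open Classical in
theorem sum_cutBasis_nodePos (hk : 1 ≤ k) {s : Finset (Space d →₀ ℕ)} {β : (Space d →₀ ℕ) → ℝ}
    (hs : ∀ a ∈ s, a ∈ cutNodes 𝒯 k Ω Ωs) {b : Space d →₀ ℕ} (hb : IsNode 𝒯 k b)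
    (hbc : nodePos k b ∈ cutDomain 𝒯 Ωs) :
    (∑ a ∈ s, β a • cutBasis 𝒯 k Ωs a) (nodePos k b) = if b ∈ s then β b else 0 := by
  have h1 : ∀ a ∈ s, (β a • cutBasis 𝒯 k Ωs a) (nodePos k b) = if a = b then β a else 0 := by
    intro a ha
    rw [Pi.smul_apply, cutBasis, Set.indicator_of_mem hbc, nodalBasis_nodePos hk (hs a ha).1.1 hb,
      smul_eq_mul]
    split_ifs <;> simp
  rw [Finset.sum_apply, Finset.sum_congr rfl h1, Finset.sum_ite_eq']

/-! ### The projections on a cell -/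

theorem cutProj_mem (hk : 1 ≤ k) {u : Space d → ℝ} (hu : u ∈ cutSpace 𝒯 k Ω Ωs) (i : Fin 2) :
    cutProj 𝒯 k Ω Ωs i u ∈ cutSpace 𝒯 k Ω Ωs := by
  classical
  obtain ⟨s, β, hs, rfl⟩ := exists_sum_eq hu
  rw [cutProj_sum hk i s hs β]
  refine Submodule.sum_mem _ fun a ha => Submodule.smul_mem _ _ (Submodule.subset_span ?_)
  exact ⟨a, hs a (Finset.mem_filter.1 ha).1, rfl⟩

/-- A node in Ω and off Γ lies in exactly one subdomain, so it belongs to exactly one of the two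
index sets; this yields u = Q₁u + Q₂u. -/
theorem mem_cutNodesOf_zero_iff (hP : IsPartition Ω Ωs)
    (hnode : ∀ a, IsNode 𝒯 k a → nodePos k a ∉ interface Ωs) {a : Space d →₀ ℕ}
    (ha : a ∈ cutNodes 𝒯 k Ω Ωs) :
    a ∈ cutNodesOf 𝒯 k Ω Ωs 0 ↔ a ∉ cutNodesOf 𝒯 k Ω Ωs 1 := by
  have hcov := hP.cover ha.1.2
  have hn := hnode a ha.1.1
  have hdis : nodePos k a ∈ Ωs 0 → nodePos k a ∉ Ωs 1 :=
    fun h => Set.disjoint_left.1 hP.disjoint h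
  simp only [Set.mem_union, hn, or_false] at hcov
  simp only [cutNodesOf, Set.mem_ofPred_eq, ha, true_and, not_not]
  tauto

theorem cutProj_add_cutProj (hk : 1 ≤ k) (hP : IsPartition Ω Ωs)
    (hnode : ∀ a, IsNode 𝒯 k a → nodePos k a ∉ interface Ωs) {u : Space d → ℝ}
    (hu : u ∈ cutSpace 𝒯 k Ω Ωs) :
    cutProj 𝒯 k Ω Ωs 0 u + cutProj 𝒯 k Ω Ωs 1 u = u := by
  classical
  obtain ⟨s, β, hs, rfl⟩ := exists_sum_eq hu
  rw [cutProj_sum hk 0 s hs β, cutProj_sum hk 1 s hs β, add_comm,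
    ← Finset.sum_filter_add_sum_filter_not s (fun a => a ∈ cutNodesOf 𝒯 k Ω Ωs 1)]
  congr 2
  refine Finset.filter_congr fun a ha => mem_cutNodesOf_zero_iff hP hnode (hs a ha)

/-- A vertex is a node. If it is not in Ω, it carries no basis function; if it is in Ω, it must lie
in Ω_i, and Q_i drops its coefficient. -/
theorem cutProj_vertex (hk : 1 ≤ k) (hP : IsPartition Ω Ωs)
    (hnode : ∀ a, IsNode 𝒯 k a → nodePos k a ∉ interface Ωs) {u : Space d → ℝ}
    (hu : u ∈ cutSpace 𝒯 k Ω Ωs) {i j : Fin 2} (hij : i ≠ j) {t : Finset (Space d)}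
    (ht : t ∈ cutCells 𝒯 Ωs) {v : Space d} (hv : v ∈ t) (hvj : v ∉ Ωs j) :
    cutProj 𝒯 k Ω Ωs i u v = 0 := by
  classical
  obtain ⟨s, β, hs, rfl⟩ := exists_sum_eq hu
  have hn := isNode_single hk ht.1.1 hv
  have hval := sum_cutBasis_nodePos (β := β) hk
    (s := s.filter fun a => a ∈ cutNodesOf 𝒯 k Ω Ωs i)
    (fun a ha => hs a (Finset.mem_filter.1 ha).1) hn
    (by rw [nodePos_single hk]; exact subset_cutDomain ht (subset_simplex t hv))
  rw [nodePos_single hk] at hval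
  rw [cutProj_sum hk i s hs β, hval, if_neg]
  intro hmem
  have h1 := (Finset.mem_filter.1 hmem).2
  have hΩ := h1.1.1.2
  have h2 := h1.2
  rw [nodePos_single hk] at hΩ h2
  have hΓ := hnode _ hn
  rw [nodePos_single hk] at hΓ
  rcases hP.cover hΩ with (h | h) | h
  · fin_cases i <;> fin_cases j <;> simp_all
  · fin_cases i <;> fin_cases j <;> simp_all
  · exact hΓ h

theorem card_labels_le {t : Finset (Space d)} (ht : t ∈ cells 𝒯) (s : Finset (Space d →₀ ℕ))
    (hs : ∀ a ∈ s, a.support ⊆ t ∧ ∑ v ∈ a.support, a v = k) :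
    s.card ≤ (k + 1) ^ (d + 1) := by
  classical
  have hle : ∀ a ∈ s, ∀ v, a v ≤ k := by
    intro a ha v
    by_cases hv : v ∈ a.support
    · rw [← (hs a ha).2]; exact Finset.single_le_sum (fun _ _ => Nat.zero_le _) hv
    · rw [Finsupp.notMem_support_iff.1 hv]; exact Nat.zero_le _
  have hcard : (Finset.univ : Finset (t → Fin (k + 1))).card = (k + 1) ^ (d + 1) := by
    rw [Finset.card_univ, Fintype.card_fun, Fintype.card_fin, Fintype.card_coe, ht.2]
  rw [← hcard]
  -- Reduction modulo k + 1 loses nothing because all entries of a label are at most k.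
  refine Finset.card_le_card_of_injOn (fun a v => Fin.ofNat (k + 1) (a v)) (by simp) ?_
  intro a ha b hb hab
  ext v
  by_cases hv : v ∈ t
  · have h1 := congrFun hab ⟨v, hv⟩
    have h2 := hle a ha v
    have h3 := hle b hb v
    have h4 := congrArg Fin.val h1
    simpa [Fin.ofNat, Nat.mod_eq_of_lt (Nat.lt_succ_of_le h2),
      Nat.mod_eq_of_lt (Nat.lt_succ_of_le h3)] using h4
  · rw [Finsupp.notMem_support_iff.1 fun h => hv ((hs a ha).1 h),
      Finsupp.notMem_support_iff.1 fun h => hv ((hs b hb).1 h)]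

/-- A bound of the projections `Q_i` in the maximum norm of a cell. -/
def projBound (d k : ℕ) : ℝ := ((k : ℝ) + 1) ^ (d + 1) * (k : ℝ) ^ k

/-- On a cell only labels supported on its vertices matter, at most (k + 1) ^ (d + 1) of them. Their
coefficients are values of `u` at nodes of the cell, and the basis functions are bounded by k ^ k.
-/
theorem abs_cutProj_le (hk : 1 ≤ k) {u : Space d → ℝ} (hu : u ∈ cutSpace 𝒯 k Ω Ωs) (i : Fin 2)
    {t : Finset (Space d)} (ht : t ∈ cutCells 𝒯 Ωs) {B : ℝ} (hB0 : 0 ≤ B)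
    (hB : ∀ y ∈ simplex t, |u y| ≤ B) {y : Space d} (hy : y ∈ simplex t) :
    |cutProj 𝒯 k Ω Ωs i u y| ≤ projBound d k * B := by
  classical
  obtain ⟨s, β, hs, rfl⟩ := exists_sum_eq hu
  rw [cutProj_sum hk i s hs β, Finset.sum_apply]
  set s' := s.filter fun a => a ∈ cutNodesOf 𝒯 k Ω Ωs i
  have hterm : ∀ a ∈ s'.filter fun a => a.support ⊆ t,
      |(β a • cutBasis 𝒯 k Ωs a) y| ≤ B * (k : ℝ) ^ k := by
    intro a ha
    rw [Finset.mem_filter] at ha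
    have has := (Finset.mem_filter.1 ha.1).1
    have hn := (hs a has).1.1
    have hpos := nodePos_mem_simplex hk hn ha.2
    have hβ := hB _ hpos
    rw [sum_cutBasis_nodePos hk hs hn (subset_cutDomain ht hpos), if_pos has] at hβ
    rw [Pi.smul_apply, cutBasis, Set.indicator_of_mem (subset_cutDomain ht hy), smul_eq_mul,
      abs_mul]
    exact mul_le_mul hβ (abs_nodalBasis_le ht.1 hn hy) (abs_nonneg _) hB0
  have hsum : ∑ a ∈ s', (β a • cutBasis 𝒯 k Ωs a) y =
      ∑ a ∈ s' with a.support ⊆ t, (β a • cutBasis 𝒯 k Ωs a) y := by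
    refine (Finset.sum_filter_of_ne fun a _ hne => ?_).symm
    by_contra hat
    apply hne
    rw [Pi.smul_apply, cutBasis, Set.indicator_of_mem (subset_cutDomain ht hy),
      nodalBasis_eq_zero ht.1 hat hy, smul_zero]
  have hcard : ((s'.filter fun a => a.support ⊆ t).card : ℝ) ≤ ((k : ℝ) + 1) ^ (d + 1) := by
    have := card_labels_le (k := k) ht.1 (s'.filter fun a => a.support ⊆ t) fun a ha => by
      rw [Finset.mem_filter] at ha
      exact ⟨ha.2, (hs a (Finset.mem_filter.1 ha.1).1).1.1.2⟩
    exact_mod_cast this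
  rw [hsum]
  refine (Finset.abs_sum_le_sum_abs _ _).trans ((Finset.sum_le_card_nsmul _ _ _ hterm).trans ?_)
  rw [nsmul_eq_mul, projBound]
  calc _ ≤ ((k : ℝ) + 1) ^ (d + 1) * (B * (k : ℝ) ^ k) := by gcongr
    _ = _ := by ring

end

/-! ### Localization of the norms and estimates on cells -/

section

variable {d : ℕ} {𝒯 : Geometry.SimplicialComplex ℝ (Space d)} {Ω : Set (Space d)}
  {Ωs : Fin 2 → Set (Space d)} {k : ℕ}

/-! ### Integrals of gradients over cells -/

theorem norm_gradient_eq_of_eqOn {t : Finset (Space d)} {f p : Space d → ℝ}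
    (hfp : ∀ y ∈ simplex t, f y = p y) {x : Space d} (hx : x ∈ interior (simplex t)) :
    ‖gradient f x‖ = ‖fderiv ℝ p x‖ := by
  have h : f =ᶠ[nhds x] p := by
    filter_upwards [mem_interior_iff_mem_nhds.1 hx] with y hy using hfp y hy
  rw [gradient, LinearIsometryEquiv.norm_map, h.fderiv_eq]

theorem ae_mem_interior_simplex (t : Finset (Space d)) :
    ∀ᵐ x ∂volume.restrict (simplex t), x ∈ interior (simplex t) := by
  rw [ae_restrict_iff' (measurableSet_simplex t)]
  have h := compl_mem_ae_iff.2 ((convex_simplex t).addHaar_frontier volume)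
  filter_upwards [h] with x hx hxt
  by_contra hxi
  exact hx ⟨subset_closure hxt, hxi⟩

theorem sq_gradient_ae_eq {t : Finset (Space d)} {f p : Space d → ℝ}
    (hfp : ∀ y ∈ simplex t, f y = p y) :
    (fun x => ‖gradient f x‖ ^ 2) =ᵐ[volume.restrict (simplex t)] fun x => ‖fderiv ℝ p x‖ ^ 2 := by
  filter_upwards [ae_mem_interior_simplex t] with x hx
  rw [norm_gradient_eq_of_eqOn hfp hx]

theorem setIntegral_sq_gradient_eq {t : Finset (Space d)} {f p : Space d → ℝ}
    (hfp : ∀ y ∈ simplex t, f y = p y) :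
    ∫ x in simplex t, ‖gradient f x‖ ^ 2 = ∫ x in simplex t, ‖fderiv ℝ p x‖ ^ 2 :=
  integral_congr_ae (sq_gradient_ae_eq hfp)

theorem integrableOn_sq_gradient {t : Finset (Space d)} {f p : Space d → ℝ}
    (hfp : ∀ y ∈ simplex t, f y = p y) (hp : p ∈ polySpace d k) :
    IntegrableOn (fun x => ‖gradient f x‖ ^ 2) (simplex t) :=
  (((continuous_fderiv_polySpace hp).norm.pow 2).continuousOn.integrableOn_compact
    (isCompact_simplex t)).congr (sq_gradient_ae_eq hfp).symm

theorem sq_gradient_ae_eq_zero (hd : 1 ≤ d) {σ : ℝ} (hσ : 0 < σ) (hT : IsShapeRegular σ 𝒯)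
    {u : Space d → ℝ} (hu : u ∈ cutSpace 𝒯 k Ω Ωs) {t : Finset (Space d)} (ht : t ∈ cells 𝒯)
    (htc : t ∉ cutCells 𝒯 Ωs) :
    (fun x => ‖gradient u x‖ ^ 2) =ᵐ[volume.restrict (simplex t)] fun _ => 0 := by
  filter_upwards [ae_mem_interior_simplex t] with x hx
  have h0 : ∀ y ∈ interior (simplex t), u y = 0 := by
    intro y hy
    refine eq_zero_of_notMem_cutDomain hu fun hyc => ?_
    simp only [cutDomain, Set.mem_iUnion] at hyc
    obtain ⟨s, hs, hys⟩ := hyc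
    have hne : t ≠ s := fun h => htc (h ▸ hs)
    have := interior_simplex_inter hd hσ hT ht hs.1 hne
    exact (Set.eq_empty_iff_forall_notMem.1 this y) ⟨hy, hys⟩
  have h : u =ᶠ[nhds x] fun _ => (0 : ℝ) := by
    filter_upwards [isOpen_interior.mem_nhds hx] with y hy using h0 y hy
  rw [gradient, LinearIsometryEquiv.norm_map, h.fderiv_eq]
  simp

theorem finite_cutCells (h𝒯 : IsTriangulation 𝒯 Ω) (Ωs : Fin 2 → Set (Space d)) :
    (cutCells 𝒯 Ωs).Finite := (finite_cells h𝒯).subset fun _ ht => ht.1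

/-- Cells overlap in null sets, and `u` vanishes in the interior of an uncut cell, so only cut cells
contribute; each of them belongs to both extended domains. -/
theorem setIntegral_extDomain (hd : 1 ≤ d) {σ : ℝ} (hσ : 0 < σ) (hT : IsShapeRegular σ 𝒯)
    (h𝒯 : IsTriangulation 𝒯 Ω) {u : Space d → ℝ} (hu : u ∈ cutSpace 𝒯 k Ω Ωs) (i : Fin 2) :
    ∫ x in extDomain 𝒯 Ωs i, ‖gradient u x‖ ^ 2 =
      ∑ t ∈ (finite_cutCells h𝒯 Ωs).toFinset, ∫ x in simplex t, ‖gradient u x‖ ^ 2 := by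
  have hfin : {t | t ∈ cells 𝒯 ∧ (simplex t ∩ Ωs i).Nonempty}.Finite :=
    (finite_cells h𝒯).subset fun _ ht => ht.1
  have hF : ∀ t, t ∈ hfin.toFinset ↔ t ∈ cells 𝒯 ∧ (simplex t ∩ Ωs i).Nonempty :=
    fun t => by simp
  set F := hfin.toFinset
  have hext : extDomain 𝒯 Ωs i = ⋃ t : F, simplex (t : Finset (Space d)) := by
    ext x
    simp only [extDomain, Set.mem_iUnion, Subtype.exists, hF, Set.mem_ofPred_eq]
  have hint : ∀ t ∈ F, IntegrableOn (fun x => ‖gradient u x‖ ^ 2) (simplex t) := by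
    intro t ht
    by_cases htc : t ∈ cutCells 𝒯 Ωs
    · obtain ⟨p, hp, hpe⟩ := exists_polySpace_eq hu htc
      exact integrableOn_sq_gradient hpe hp
    · exact (integrable_zero _ _ _).congr
        (sq_gradient_ae_eq_zero hd hσ hT hu ((hF t).1 ht).1 htc).symm
  have hdisj : Pairwise (Function.onFun (AEDisjoint volume)
      fun t : F => simplex (t : Finset (Space d))) := by
    intro s t hst
    exact volume_simplex_inter ((hF s).1 s.2).1 ((hF t).1 t.2).1 fun h => hst (Subtype.ext h)
  rw [hext, integral_iUnion_ae (fun t => (measurableSet_simplex _).nullMeasurableSet) hdisj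
    (integrableOn_finite_iUnion.2 fun t => hint t t.2), tsum_fintype,
    Finset.sum_coe_sort F (fun t => ∫ x in simplex t, ‖gradient u x‖ ^ 2)]
  refine (Finset.sum_subset (fun t ht => ?_) fun t ht htc => ?_).symm
  · rw [Set.Finite.mem_toFinset] at ht
    exact (hF t).2 ⟨ht.1, ht.2 i⟩
  · rw [Set.Finite.mem_toFinset] at htc
    rw [integral_congr_ae (sq_gradient_ae_eq_zero hd hσ hT hu ((hF t).1 ht).1 htc)]
    simp

/-! ### The norms as sums over the cut cells -/

/-- The contribution of the cell `t` to `‖(0, u)‖_b²`. -/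
def localEnergy (𝒯 : Geometry.SimplicialComplex ℝ (Space d)) (k : ℕ) (Ω : Set (Space d))
    (Ωs : Fin 2 → Set (Space d)) (u : Space d → ℝ) (t : Finset (Space d)) : ℝ :=
  ∑ i : Fin 2, (∫ x in simplex t, ‖gradient (cutProj 𝒯 k Ω Ωs i u) x‖ ^ 2) +
    (meshSize t)⁻¹ * ∫ x in simplex t ∩ interface Ωs,
      (cutProj 𝒯 k Ω Ωs 0 u x - cutProj 𝒯 k Ω Ωs 1 u x) ^ 2 ∂(μHE[d - 1])

theorem bNorm_eq (hd : 1 ≤ d) (hk : 1 ≤ k) {σ : ℝ} (hσ : 0 < σ) (hT : IsShapeRegular σ 𝒯)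
    (h𝒯 : IsTriangulation 𝒯 Ω) (u : cutSpace 𝒯 k Ω Ωs) :
    bNorm 𝒯 k Ω Ωs (0, u) =
      Real.sqrt (∑ t ∈ (finite_cutCells h𝒯 Ωs).toFinset, localEnergy 𝒯 k Ω Ωs u t) := by
  have hcomp : ∀ i, component 𝒯 k Ω Ωs (0, u) i = cutProj 𝒯 k Ω Ωs i u := fun i => by
    simp [component]
  simp only [bNorm, hcomp, interfaceNormSq, localEnergy, Pi.sub_apply]
  rw [finsum_mem_eq_finite_toFinset_sum _ (finite_cutCells h𝒯 Ωs), Finset.sum_add_distrib,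
    Finset.sum_comm]
  congr 2
  exact Finset.sum_congr rfl fun i _ =>
    setIntegral_extDomain hd hσ hT h𝒯 (cutProj_mem hk u.2 i) i

theorem scaledL2Norm_eq (h𝒯 : IsTriangulation 𝒯 Ω) (u : Space d → ℝ) :
    scaledL2Norm 𝒯 Ωs u = Real.sqrt (∑ t ∈ (finite_cutCells h𝒯 Ωs).toFinset,
      (meshSize t ^ 2)⁻¹ * ∫ x in simplex t, u x ^ 2) := by
  rw [scaledL2Norm, finsum_mem_eq_finite_toFinset_sum _ (finite_cutCells h𝒯 Ωs)]

theorem setIntegral_sq_gradient_le_localEnergy (u : Space d → ℝ) (t : Finset (Space d))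
    (i : Fin 2) : ∫ x in simplex t, ‖gradient (cutProj 𝒯 k Ω Ωs i u) x‖ ^ 2 ≤
      localEnergy 𝒯 k Ω Ωs u t := by
  have h0 : ∀ i, 0 ≤ ∫ x in simplex t, ‖gradient (cutProj 𝒯 k Ω Ωs i u) x‖ ^ 2 :=
    fun i => integral_nonneg fun x => sq_nonneg _
  have h1 : 0 ≤ (meshSize t)⁻¹ * ∫ x in simplex t ∩ interface Ωs,
      (cutProj 𝒯 k Ω Ωs 0 u x - cutProj 𝒯 k Ω Ωs 1 u x) ^ 2 ∂(μHE[d - 1]) :=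
    mul_nonneg (inv_nonneg.2 Metric.diam_nonneg) (integral_nonneg fun _ => sq_nonneg _)
  have h2 := Finset.single_le_sum (f := fun i => ∫ x in simplex t,
    ‖gradient (cutProj 𝒯 k Ω Ωs i u) x‖ ^ 2) (fun i _ => h0 i) (Finset.mem_univ i)
  rw [localEnergy]
  exact h2.trans (le_add_of_nonneg_right h1)

theorem localEnergy_nonneg (u : Space d → ℝ) (t : Finset (Space d)) :
    0 ≤ localEnergy 𝒯 k Ω Ωs u t :=
  (integral_nonneg fun _ => sq_nonneg _).trans (setIntegral_sq_gradient_le_localEnergy u t 0)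

theorem setIntegral_sq_jump_le_localEnergy {t : Finset (Space d)} (hh : 0 < meshSize t)
    (u : Space d → ℝ) : ∫ x in simplex t ∩ interface Ωs,
      (cutProj 𝒯 k Ω Ωs 0 u x - cutProj 𝒯 k Ω Ωs 1 u x) ^ 2 ∂(μHE[d - 1]) ≤
      meshSize t * localEnergy 𝒯 k Ω Ωs u t := by
  have h0 : 0 ≤ ∑ i : Fin 2, ∫ x in simplex t, ‖gradient (cutProj 𝒯 k Ω Ωs i u) x‖ ^ 2 :=
    Finset.sum_nonneg fun i _ => integral_nonneg fun x => sq_nonneg _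
  rw [localEnergy, mul_add, mul_inv_cancel_left₀ hh.ne']
  exact le_add_of_nonneg_left (mul_nonneg hh.le h0)

/-! ### Inverse and Poincaré estimates on cells -/

theorem exists_ball_in_cell (hd : 1 ≤ d) {σ : ℝ} (hσ : 0 < σ) (hT : IsShapeRegular σ 𝒯)
    {t : Finset (Space d)} (ht : t ∈ cells 𝒯) :
    ∃ z, Metric.closedBall z (meshSize t * σ⁻¹) ⊆ simplex t ∧
      ∀ y ∈ simplex t, dist y z ≤ meshSize t := by
  obtain ⟨z, hz⟩ := hT t ht
  have := meshSize_pos hd ht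
  exact ⟨z, hz, fun y hy => dist_le_meshSize hy (hz (Metric.mem_closedBall_self (by positivity)))⟩

/-- The volume of the unit ball. -/
def ballVol (d : ℕ) : ℝ := volume.real (Metric.ball (0 : Space d) 1)

theorem ballVol_pos (d : ℕ) : 0 < ballVol d :=
  ENNReal.toReal_pos (Metric.measure_ball_pos _ _ one_pos).ne' measure_ball_lt_top.ne

theorem volume_simplex_le (hd : 1 ≤ d) {t : Finset (Space d)} (ht : t ∈ cells 𝒯) :
    volume.real (simplex t) ≤ meshSize t ^ d * ballVol d := by
  have hh := meshSize_pos hd ht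
  obtain ⟨v, hv⟩ := 𝒯.nonempty_of_mem_faces ht.1
  have hsub : simplex t ⊆ Metric.closedBall v (meshSize t) :=
    fun y hy => dist_le_meshSize hy (subset_simplex t hv)
  refine (measureReal_mono hsub (isCompact_closedBall v _).measure_lt_top.ne).trans_eq ?_
  rw [Measure.real, Measure.addHaar_closedBall _ _ hh.le, finrank_euclideanSpace_fin,
    ENNReal.toReal_mul, ENNReal.toReal_ofReal (by positivity)]
  rfl

theorem setIntegral_le_of_forall_le (hd : 1 ≤ d) {t : Finset (Space d)} (ht : t ∈ cells 𝒯)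
    {g : Space d → ℝ} {B : ℝ} (hB : 0 ≤ B) (hg : ∀ y ∈ simplex t, ‖g y‖ ≤ B) :
    ∫ x in simplex t, g x ≤ ballVol d * (meshSize t ^ d * B) := by
  have h := norm_setIntegral_le_of_norm_le_const (μ := volume) (isCompact_simplex t).measure_lt_top hg
  calc ∫ x in simplex t, g x ≤ B * volume.real (simplex t) := (Real.le_norm_self _).trans h
    _ ≤ B * (meshSize t ^ d * ballVol d) := by
        gcongr
        exact volume_simplex_le hd ht
    _ = _ := by ring

theorem setIntegral_sq_le (hd : 1 ≤ d) {t : Finset (Space d)} (ht : t ∈ cells 𝒯)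
    {f : Space d → ℝ} {B : ℝ} (hB : 0 ≤ B) (hf : ∀ y ∈ simplex t, f y ^ 2 ≤ B) :
    ∫ x in simplex t, f x ^ 2 ≤ ballVol d * (meshSize t ^ d * B) :=
  setIntegral_le_of_forall_le hd ht hB fun y hy => by
    rw [Real.norm_of_nonneg (sq_nonneg _)]
    exact hf y hy

theorem exists_sq_le (hd : 1 ≤ d) (k : ℕ) {σ : ℝ} (hσ : 0 < σ) :
    ∃ C : ℝ, 0 < C ∧ ∀ 𝒯 : Geometry.SimplicialComplex ℝ (Space d), IsShapeRegular σ 𝒯 →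
      ∀ t ∈ cells 𝒯, ∀ f : Space d → ℝ, ∀ p ∈ polySpace d k, (∀ y ∈ simplex t, f y = p y) →
      ∀ y ∈ simplex t, f y ^ 2 ≤ C * ((meshSize t ^ d)⁻¹ * ∫ x in simplex t, f x ^ 2) := by
  obtain ⟨C, hC, hle⟩ := exists_sq_le_integral_sq d k (inv_pos.2 hσ)
  refine ⟨C, hC, fun 𝒯 hT t ht f p hp hfp y hy => ?_⟩
  obtain ⟨z, hz, hzd⟩ := exists_ball_in_cell hd hσ hT ht
  rw [setIntegral_congr_fun (measurableSet_simplex t) fun x hx => by rw [hfp x hx], hfp y hy]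
  exact hle p hp z _ (meshSize_pos hd ht) _ (isCompact_simplex t) hz y (hzd y hy)

theorem exists_setIntegral_sq_gradient_le (hd : 2 ≤ d) (k : ℕ) {σ : ℝ} (hσ : 0 < σ) :
    ∃ C : ℝ, 0 < C ∧ ∀ 𝒯 : Geometry.SimplicialComplex ℝ (Space d), IsShapeRegular σ 𝒯 →
      ∀ t ∈ cells 𝒯, ∀ f : Space d → ℝ, ∀ p ∈ polySpace d k, (∀ y ∈ simplex t, f y = p y) →
      ∀ B, 0 ≤ B → (∀ y ∈ simplex t, f y ^ 2 ≤ B) →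
      ∫ x in simplex t, ‖gradient f x‖ ^ 2 ≤ C * (meshSize t ^ (d - 2) * B) := by
  obtain ⟨C, hC, hle⟩ := exists_sq_fderiv_le_integral_sq d k (inv_pos.2 hσ)
  have hω := ballVol_pos d
  refine ⟨ballVol d * (C * ballVol d), by positivity, fun 𝒯 hT t ht f p hp hfp B hB0 hB => ?_⟩
  obtain ⟨z, hz, hzd⟩ := exists_ball_in_cell (by omega) hσ hT ht
  have hh := meshSize_pos (by omega) ht
  have hint : ∫ x in simplex t, p x ^ 2 ≤ ballVol d * (meshSize t ^ d * B) :=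
    setIntegral_sq_le (by omega) ht hB0 fun y hy => by rw [← hfp y hy]; exact hB y hy
  have hgrad : ∀ y ∈ simplex t, ‖fderiv ℝ p y‖ ^ 2 ≤ C * ballVol d * B * (meshSize t ^ 2)⁻¹ := by
    intro y hy
    have h1 := hle p hp z _ hh _ (isCompact_simplex t) hz y (hzd y hy)
    rw [← div_eq_mul_inv, le_div_iff₀ (by positivity), mul_comm]
    calc _ ≤ C * ((meshSize t ^ d)⁻¹ * ∫ x in simplex t, p x ^ 2) := h1
      _ ≤ C * ((meshSize t ^ d)⁻¹ * (ballVol d * (meshSize t ^ d * B))) := by gcongr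
      _ = C * ballVol d * B := by field_simp
  rw [setIntegral_sq_gradient_eq hfp]
  refine (setIntegral_le_of_forall_le (by omega) ht
    (B := C * ballVol d * B * (meshSize t ^ 2)⁻¹) (by positivity) fun y hy => by
    rw [Real.norm_of_nonneg (sq_nonneg _)]
    exact hgrad y hy).trans_eq ?_
  -- Writing d = n + 2 removes the truncated subtraction in d - 2.
  obtain ⟨n, rfl⟩ := Nat.exists_eq_add_of_le' hd
  rw [Nat.add_sub_cancel, pow_add]
  field_simp

theorem exists_sq_sub_le (hd : 2 ≤ d) (k : ℕ) {σ : ℝ} (hσ : 0 < σ) :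
    ∃ C : ℝ, 0 < C ∧ ∀ 𝒯 : Geometry.SimplicialComplex ℝ (Space d), IsShapeRegular σ 𝒯 →
      ∀ t ∈ cells 𝒯, ∀ f : Space d → ℝ, ∀ p ∈ polySpace d k, (∀ y ∈ simplex t, f y = p y) →
      ∀ y ∈ simplex t, ∀ y' ∈ simplex t, (f y - f y') ^ 2 ≤
        C * ((meshSize t ^ (d - 2))⁻¹ * ∫ x in simplex t, ‖gradient f x‖ ^ 2) := by
  obtain ⟨C, hC, hle⟩ := exists_sq_sub_le_integral_sq_fderiv d k (inv_pos.2 hσ)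
  refine ⟨C, hC, fun 𝒯 hT t ht f p hp hfp y hy y' hy' => ?_⟩
  obtain ⟨z, hz, hzd⟩ := exists_ball_in_cell (by omega) hσ hT ht
  have hh := meshSize_pos (by omega) ht
  rw [setIntegral_sq_gradient_eq hfp, hfp y hy, hfp y' hy']
  refine (hle p hp z _ hh _ (isCompact_simplex t) hz y y' (hzd y hy) (hzd y' hy')).trans_eq ?_
  obtain ⟨n, rfl⟩ := Nat.exists_eq_add_of_le' hd
  rw [Nat.add_sub_cancel, pow_add]
  field_simp

end

/-! ### The two bounds cell by cell -/

section

variable {d : ℕ} {𝒯 : Geometry.SimplicialComplex ℝ (Space d)} {Ω : Set (Space d)}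
  {Ωs : Fin 2 → Set (Space d)} {k : ℕ}

/-! ### The upper bound -/

theorem interface_measureReal_le {C : ℝ} (hC : 0 < C) {t : Finset (Space d)}
    (h : μHE[d - 1] (simplex t ∩ interface Ωs) ≤ ENNReal.ofReal (C * meshSize t ^ (d - 1))) :
    (μHE[d - 1]).real (simplex t ∩ interface Ωs) ≤ C * meshSize t ^ (d - 1) := by
  have hh : 0 ≤ meshSize t := Metric.diam_nonneg
  exact ENNReal.toReal_le_of_le_ofReal (by positivity) h

theorem exists_localEnergy_le (hd : 2 ≤ d) (hk : 1 ≤ k) (hΩ : IsBoundedDomain Ω) {σ K r : ℝ}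
    (hσ : 0 < σ) (hK : 0 < K) (hr : 0 < r) :
    ∃ C : ℝ, 0 < C ∧ ∀ Ωs : Fin 2 → Set (Space d), IsPartition Ω Ωs →
      IsRegularHypersurface K r (interface Ωs) →
      ∀ 𝒯 : Geometry.SimplicialComplex ℝ (Space d), IsShapeRegular σ 𝒯 →
      ∀ u ∈ cutSpace 𝒯 k Ω Ωs, ∀ t ∈ cutCells 𝒯 Ωs,
      localEnergy 𝒯 k Ω Ωs u t ≤ C * ((meshSize t ^ 2)⁻¹ * ∫ x in simplex t, u x ^ 2) := by
  obtain ⟨C₁, hC₁, h₁⟩ := exists_sq_le (d := d) (by omega) k hσ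
  obtain ⟨C₂, hC₂, h₂⟩ := exists_setIntegral_sq_gradient_le hd k hσ
  obtain ⟨C₃, hC₃, h₃⟩ := exists_interface_measure_le hΩ hK hr
  have hP : 0 < projBound d k := by
    have : 0 < k := hk
    unfold projBound; positivity
  -- Two gradient terms, and a jump term with (a - b)² ≤ 2a² + 2b²; the remaining factors bound both
  -- projections pointwise by the L² norm of `u`.
  refine ⟨(2 * C₂ + 4 * C₃) * projBound d k ^ 2 * C₁, by positivity, ?_⟩
  intro Ωs hpart hreg 𝒯 hT u hu t ht
  have hh := meshSize_pos (by omega) ht.1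
  have hμ := h₃ Ωs hpart hreg t
  set h := meshSize t
  set I := ∫ x in simplex t, u x ^ 2 with hI
  have hI0 : 0 ≤ I := integral_nonneg fun x => sq_nonneg _
  obtain ⟨p, hp, hup⟩ := exists_polySpace_eq hu ht
  set b := C₁ * ((h ^ d)⁻¹ * I) with hb
  have hb0 : 0 ≤ b := by positivity
  have hub : ∀ y ∈ simplex t, |u y| ≤ Real.sqrt b := fun y hy =>
    Real.abs_le_sqrt (h₁ 𝒯 hT t ht.1 u p hp hup y hy)
  have hQ : ∀ i, ∀ y ∈ simplex t, cutProj 𝒯 k Ω Ωs i u y ^ 2 ≤ projBound d k ^ 2 * b := by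
    intro i y hy
    have := abs_cutProj_le hk hu i ht (Real.sqrt_nonneg b) hub hy
    rw [← sq_abs]
    calc |cutProj 𝒯 k Ω Ωs i u y| ^ 2 ≤ (projBound d k * Real.sqrt b) ^ 2 := by gcongr
      _ = _ := by rw [mul_pow, Real.sq_sqrt hb0]
  have hgrad : ∀ i, ∫ x in simplex t, ‖gradient (cutProj 𝒯 k Ω Ωs i u) x‖ ^ 2 ≤
      C₂ * (h ^ (d - 2) * (projBound d k ^ 2 * b)) := by
    intro i
    obtain ⟨q, hq, hqe⟩ := exists_polySpace_eq (cutProj_mem hk hu i) ht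
    exact h₂ 𝒯 hT t ht.1 _ q hq hqe _ (by positivity) (hQ i)
  have hjump : ∫ x in simplex t ∩ interface Ωs,
      (cutProj 𝒯 k Ω Ωs 0 u x - cutProj 𝒯 k Ω Ωs 1 u x) ^ 2 ∂(μHE[d - 1]) ≤
      4 * (projBound d k ^ 2 * b) * (C₃ * h ^ (d - 1)) := by
    have hle := norm_setIntegral_le_of_norm_le_const (μ := (μHE[d - 1] : Measure (Space d)))
      (s := simplex t ∩ interface Ωs) (hμ.trans_lt ENNReal.ofReal_lt_top)
      (f := fun x => (cutProj 𝒯 k Ω Ωs 0 u x - cutProj 𝒯 k Ω Ωs 1 u x) ^ 2)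
      (C := 4 * (projBound d k ^ 2 * b)) fun y hy => by
        rw [Real.norm_of_nonneg (sq_nonneg _)]
        have e0 := hQ 0 y hy.1
        have e1 := hQ 1 y hy.1
        nlinarith [sq_nonneg (cutProj 𝒯 k Ω Ωs 0 u y + cutProj 𝒯 k Ω Ωs 1 u y)]
    refine (Real.le_norm_self _).trans (hle.trans ?_)
    gcongr
    exact interface_measureReal_le hC₃ hμ
  rw [localEnergy, Fin.sum_univ_two]
  calc _ ≤ C₂ * (h ^ (d - 2) * (projBound d k ^ 2 * b)) +
        C₂ * (h ^ (d - 2) * (projBound d k ^ 2 * b)) +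
        h⁻¹ * (4 * (projBound d k ^ 2 * b) * (C₃ * h ^ (d - 1))) := by
        gcongr
        · exact hgrad 0
        · exact hgrad 1
    _ = _ := by
        rw [hb]
        obtain ⟨n, rfl⟩ := Nat.exists_eq_add_of_le' hd
        rw [Nat.add_sub_cancel, show n + 2 - 1 = n + 1 by omega, pow_add, pow_succ]
        field_simp
        ring

/-! ### The lower bound -/

/-- Write a = (a - f) + (f - g) + g, so that a² ≤ 6 X + 3 (f - g)² on `s`, and average over `s`. It
will be applied on Γ ∩ T' with `a` the value at a vertex, `f` the projection to be bounded and `g`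
the other one. -/
theorem sq_le_of_integral_sq_sub {α : Type*} [MeasurableSpace α] {μ : Measure α} {s : Set α}
    (hs : MeasurableSet s) (hμ : μ s ≠ ⊤) {f g : α → ℝ}
    (hint : IntegrableOn (fun x => (f x - g x) ^ 2) s μ) {a X m : ℝ} (hm : 0 < m)
    (hmμ : m ≤ μ.real s) (hf : ∀ x ∈ s, (f x - a) ^ 2 ≤ X) (hg : ∀ x ∈ s, g x ^ 2 ≤ X) :
    a ^ 2 ≤ 6 * X + 3 * (m⁻¹ * ∫ x in s, (f x - g x) ^ 2 ∂μ) := by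
  have hpt : ∀ x ∈ s, a ^ 2 - 6 * X ≤ 3 * (f x - g x) ^ 2 := by
    intro x hx
    have h1 := hf x hx
    have h2 := hg x hx
    nlinarith [sq_nonneg ((f x - a) + (f x - g x)), sq_nonneg ((f x - g x) - g x),
      sq_nonneg ((f x - a) + g x)]
  have hI : 0 ≤ ∫ x in s, (f x - g x) ^ 2 ∂μ := integral_nonneg fun x => sq_nonneg _
  rcases le_or_gt (a ^ 2 - 6 * X) 0 with hneg | hpos
  · have : 0 ≤ 3 * (m⁻¹ * ∫ x in s, (f x - g x) ^ 2 ∂μ) := by positivity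
    linarith
  -- Positivity of a² - 6 X is what allows the measure of `s` to be replaced by its lower bound `m`
  -- afterwards.
  have h1 : μ.real s * (a ^ 2 - 6 * X) ≤ 3 * ∫ x in s, (f x - g x) ^ 2 ∂μ := by
    rw [← integral_const_mul, ← smul_eq_mul, ← setIntegral_const]
    exact setIntegral_mono_on (integrableOn_const hμ) (hint.const_mul 3) hs hpt
  have h2 : m * (a ^ 2 - 6 * X) ≤ 3 * ∫ x in s, (f x - g x) ^ 2 ∂μ :=
    (mul_le_mul_of_nonneg_right hmμ hpos.le).trans h1
  have h3 : a ^ 2 - 6 * X ≤ m⁻¹ * (3 * ∫ x in s, (f x - g x) ^ 2 ∂μ) := by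
    rwa [le_inv_mul_iff₀ hm]
  linarith [h3, show m⁻¹ * (3 * ∫ x in s, (f x - g x) ^ 2 ∂μ) =
    3 * (m⁻¹ * ∫ x in s, (f x - g x) ^ 2 ∂μ) by ring]

theorem integrableOn_sq_sub {μ : Measure (Space d)} {t : Finset (Space d)} {s : Set (Space d)}
    (hs : MeasurableSet s) (hst : s ⊆ simplex t) (hμ : μ s ≠ ⊤) {f g p q : Space d → ℝ}
    (hp : p ∈ polySpace d k) (hq : q ∈ polySpace d k) (hfp : ∀ y ∈ simplex t, f y = p y)
    (hgq : ∀ y ∈ simplex t, g y = q y) : IntegrableOn (fun x => (f x - g x) ^ 2) s μ := by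
  have hc : Continuous fun x => (p x - q x) ^ 2 :=
    ((continuous_of_mem_polySpace hp).sub (continuous_of_mem_polySpace hq)).pow 2
  obtain ⟨M, hM⟩ := (isCompact_simplex t).exists_bound_of_continuousOn hc.continuousOn
  have h1 : IntegrableOn (fun x => (p x - q x) ^ 2) s μ :=
    Measure.integrableOn_of_bounded (M := M) hμ hc.aestronglyMeasurable
      ((ae_restrict_iff' hs).2 (Filter.Eventually.of_forall fun x hx => hM x (hst hx)))
  refine h1.congr_fun (fun x hx => ?_) hs
  simp only [hfp x (hst hx), hgq x (hst hx)]

open Classical in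
/-- The energy of the cut cells that share a vertex with `t`. -/
def patchEnergy (h𝒯 : IsTriangulation 𝒯 Ω) (k : ℕ) (Ωs : Fin 2 → Set (Space d))
    (u : Space d → ℝ) (t : Finset (Space d)) : ℝ :=
  ∑ t' ∈ (finite_cutCells h𝒯 Ωs).toFinset with ∃ v ∈ t, v ∈ t', localEnergy 𝒯 k Ω Ωs u t'

theorem localEnergy_le_patchEnergy (h𝒯 : IsTriangulation 𝒯 Ω) (u : Space d → ℝ)
    {t t' : Finset (Space d)} (ht' : t' ∈ cutCells 𝒯 Ωs) (h : ∃ v ∈ t, v ∈ t') :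
    localEnergy 𝒯 k Ω Ωs u t' ≤ patchEnergy h𝒯 k Ωs u t :=
  Finset.single_le_sum (f := fun t' => localEnergy 𝒯 k Ω Ωs u t')
    (fun _ _ => localEnergy_nonneg _ _)
    (Finset.mem_filter.2 ⟨(Set.Finite.mem_toFinset _).2 ht', h⟩)

/-- Sharing a vertex is symmetric, so after exchanging the sums each cell is counted once per
neighbour, at most (d + 1) σ ^ d times. -/
theorem sum_patchEnergy_le (hd : 1 ≤ d) {σ : ℝ} (hσ : 0 < σ) (hT : IsShapeRegular σ 𝒯)
    (h𝒯 : IsTriangulation 𝒯 Ω) (u : Space d → ℝ) :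
    ∑ t ∈ (finite_cutCells h𝒯 Ωs).toFinset, patchEnergy h𝒯 k Ωs u t ≤
      (d + 1) * σ ^ d * ∑ t ∈ (finite_cutCells h𝒯 Ωs).toFinset, localEnergy 𝒯 k Ω Ωs u t := by
  classical
  simp only [patchEnergy, Finset.sum_filter]
  rw [Finset.sum_comm, Finset.mul_sum]
  refine Finset.sum_le_sum fun t' ht' => ?_
  rw [← Finset.sum_filter, Finset.sum_const, nsmul_eq_mul]
  refine mul_le_mul_of_nonneg_right ?_ (localEnergy_nonneg u t')
  rw [Set.Finite.mem_toFinset] at ht'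
  refine card_neighbours_le hd hσ hT ht'.1 _ fun t ht => ?_
  rw [Finset.mem_filter, Set.Finite.mem_toFinset] at ht
  obtain ⟨v, hv, hv'⟩ := ht.2
  exact ⟨ht.1.1, v, hv', hv⟩

/-- The core of the lower bound: find a vertex of `t` at which Q_i u is controlled, then spread the
control over `t` by the Poincaré estimate. -/
theorem exists_sq_cutProj_le (hd : 2 ≤ d) (hk : 1 ≤ k) (hΩ : IsBoundedDomain Ω) {σ K r : ℝ}
    (hσ : 0 < σ) (hK : 0 < K) (hr : 0 < r) :
    ∃ C : ℝ, 0 < C ∧ ∀ Ωs : Fin 2 → Set (Space d), IsPartition Ω Ωs →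
      IsRegularHypersurface K r (interface Ωs) →
      ∀ 𝒯 : Geometry.SimplicialComplex ℝ (Space d), ∀ h𝒯 : IsTriangulation 𝒯 Ω,
      IsShapeRegular σ 𝒯 → (∀ a, IsNode 𝒯 k a → nodePos k a ∉ interface Ωs) →
      ∀ u ∈ cutSpace 𝒯 k Ω Ωs, ∀ t ∈ cutCells 𝒯 Ωs, ∀ i j : Fin 2, i ≠ j → ∀ y ∈ simplex t,
      cutProj 𝒯 k Ω Ωs i u y ^ 2 ≤ C * ((meshSize t ^ (d - 2))⁻¹ * patchEnergy h𝒯 k Ωs u t) := by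
  obtain ⟨C₁, hC₁, h₁⟩ := exists_sq_sub_le hd k hσ
  obtain ⟨C₃, hC₃, h₃⟩ := exists_interface_measure_le hΩ hK hr
  obtain ⟨c, hc, h₄⟩ := exists_interface_measure_ge hd hΩ hσ hK hr
  have hM := meshRatio_pos d σ
  set M := meshRatio d σ
  -- Twice the oscillation on `t` plus twice the vertex bound; the powers of M convert the size of
  -- the neighbour into that of `t`.
  refine ⟨2 * C₁ + 2 * (6 * (C₁ * M ^ (d - 2)) + 3 * (c⁻¹ * M)), by positivity, ?_⟩
  intro Ωs hP hreg 𝒯 h𝒯 hT hnode u hu t ht i j hij y hy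
  have hvert : ∀ t ∈ cells 𝒯, ∀ v ∈ t, v ∉ interface Ωs := fun t ht v hv => by
    have := hnode _ (isNode_single hk ht.1 hv)
    rwa [nodePos_single hk] at this
  have hh := meshSize_pos (by omega) ht.1
  have hosc : ∀ t ∈ cutCells 𝒯 Ωs, ∀ i, ∀ y ∈ simplex t, ∀ y' ∈ simplex t,
      (cutProj 𝒯 k Ω Ωs i u y - cutProj 𝒯 k Ω Ωs i u y') ^ 2 ≤
        C₁ * ((meshSize t ^ (d - 2))⁻¹ * localEnergy 𝒯 k Ω Ωs u t) := by
    intro t ht i y hy y' hy'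
    obtain ⟨q, hq, hqe⟩ := exists_polySpace_eq (cutProj_mem hk hu i) ht
    have hh := meshSize_pos (by omega) ht.1
    refine (h₁ 𝒯 hT t ht.1 _ q hq hqe y hy y' hy').trans ?_
    gcongr
    exact setIntegral_sq_gradient_le_localEnergy u t i
  obtain ⟨v₀, hv₀⟩ := 𝒯.nonempty_of_mem_faces ht.1.1
  have hself := localEnergy_le_patchEnergy (k := k) h𝒯 u ht ⟨v₀, hv₀, hv₀⟩
  set P := patchEnergy h𝒯 k Ωs u t
  have hP0 : 0 ≤ P := (localEnergy_nonneg u t).trans hself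
  have hvertex : ∃ v ∈ t, cutProj 𝒯 k Ω Ωs i u v ^ 2 ≤
      (6 * (C₁ * M ^ (d - 2)) + 3 * (c⁻¹ * M)) * ((meshSize t ^ (d - 2))⁻¹ * P) := by
    -- If some vertex lies outside Ω_j, then Q_i u vanishes there. Otherwise all vertices are
    -- interior, and a neighbour with a large piece of Γ exists.
    by_cases hall : ∀ v ∈ t, v ∈ Ωs j
    · obtain ⟨t', ht', ⟨v, hv, hv'⟩, hmeas⟩ := h₄ Ωs hP hreg 𝒯 h𝒯 hT hvert t ht
        fun v hv => hP.subset j (hall v hv)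
      refine ⟨v, hv, ?_⟩
      have hh' := meshSize_pos (by omega) ht'.1
      have hvi : v ∉ Ωs i := by
        have hdis := Set.disjoint_left.1 hP.disjoint
        intro hvi
        have hvj := hall v hv
        fin_cases i <;> fin_cases j
        · exact hij rfl
        · exact hdis hvi hvj
        · exact hdis hvj hvi
        · exact hij rfl
      -- The shared vertex lies in Ω_j, so Q_j drops it; hence Q_j u is bounded on `t'` by its
      -- oscillation alone.
      have hQj : cutProj 𝒯 k Ω Ωs j u v = 0 := cutProj_vertex hk hP hnode hu hij.symm ht' hv' hvi
      have hvt' := subset_simplex t' hv'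
      have hμ := h₃ Ωs hP hreg t'
      have hμt : μHE[d - 1] (simplex t' ∩ interface Ωs) ≠ ⊤ :=
        (hμ.trans_lt ENNReal.ofReal_lt_top).ne
      have hmeas' : c * meshSize t ^ (d - 1) ≤ (μHE[d - 1]).real (simplex t' ∩ interface Ωs) :=
        (ENNReal.ofReal_le_iff_le_toReal hμt).1 hmeas
      have hms : MeasurableSet (simplex t' ∩ interface Ωs) :=
        (measurableSet_simplex t').inter (isClosed_interface Ωs).measurableSet
      obtain ⟨p, hp, hpe⟩ := exists_polySpace_eq (cutProj_mem hk hu i) ht'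
      obtain ⟨q, hq, hqe⟩ := exists_polySpace_eq (cutProj_mem hk hu j) ht'
      have hE := localEnergy_le_patchEnergy (k := k) h𝒯 u ht' ⟨v, hv, hv'⟩
      have hE0 := localEnergy_nonneg (𝒯 := 𝒯) (Ω := Ω) (Ωs := Ωs) (k := k) u t'
      have hbound := sq_le_of_integral_sq_sub hms hμt
        (integrableOn_sq_sub hms Set.inter_subset_left hμt hp hq hpe hqe)
        (show 0 < c * meshSize t ^ (d - 1) by positivity) hmeas'
        (fun x hx => hosc t' ht' i x hx.1 v hvt')
        (fun x hx => by simpa [hQj] using hosc t' ht' j x hx.1 v hvt')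
      have hjump : ∫ x in simplex t' ∩ interface Ωs,
          (cutProj 𝒯 k Ω Ωs i u x - cutProj 𝒯 k Ω Ωs j u x) ^ 2 ∂(μHE[d - 1]) ≤
          meshSize t' * localEnergy 𝒯 k Ω Ωs u t' := by
        have h0 := setIntegral_sq_jump_le_localEnergy (𝒯 := 𝒯) (Ω := Ω) (Ωs := Ωs) (k := k) hh' u
        fin_cases i <;> fin_cases j
        · exact absurd rfl hij
        · exact h0
        · refine (integral_congr_ae (Filter.Eventually.of_forall fun x => ?_)).trans_le h0
          exact sub_sq_comm _ _
        · exact absurd rfl hij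
      have hvΩ := hP.subset j (hall v hv)
      have hr₁ : meshSize t' ≤ M * meshSize t :=
        meshSize_le_of_shared_vertex hd hΩ.isOpen h𝒯 hσ hT hvΩ ht.1 hv ht'.1 hv'
      have hr₂ : meshSize t ≤ M * meshSize t' :=
        meshSize_le_of_shared_vertex hd hΩ.isOpen h𝒯 hσ hT hvΩ ht'.1 hv' ht.1 hv
      have hX : C₁ * ((meshSize t' ^ (d - 2))⁻¹ * localEnergy 𝒯 k Ω Ωs u t') ≤
          C₁ * M ^ (d - 2) * ((meshSize t ^ (d - 2))⁻¹ * P) := by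
        have hinv : (meshSize t' ^ (d - 2))⁻¹ ≤ M ^ (d - 2) * (meshSize t ^ (d - 2))⁻¹ := by
          rw [← div_eq_mul_inv, le_div_iff₀ (by positivity), inv_mul_le_iff₀ (by positivity),
            ← mul_pow, mul_comm]
          gcongr
        calc _ ≤ C₁ * ((M ^ (d - 2) * (meshSize t ^ (d - 2))⁻¹) * P) := by gcongr
          _ = _ := by ring
      have hJ : (c * meshSize t ^ (d - 1))⁻¹ * ∫ x in simplex t' ∩ interface Ωs,
          (cutProj 𝒯 k Ω Ωs i u x - cutProj 𝒯 k Ω Ωs j u x) ^ 2 ∂(μHE[d - 1]) ≤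
          c⁻¹ * M * ((meshSize t ^ (d - 2))⁻¹ * P) := by
        calc _ ≤ (c * meshSize t ^ (d - 1))⁻¹ * (meshSize t' * localEnergy 𝒯 k Ω Ωs u t') := by
              gcongr
          _ ≤ (c * meshSize t ^ (d - 1))⁻¹ * (M * meshSize t * P) := by gcongr
          _ = _ := by
              rw [show d - 1 = d - 2 + 1 by omega, pow_succ]
              field_simp
      calc _ ≤ _ := hbound
        _ ≤ 6 * (C₁ * M ^ (d - 2) * ((meshSize t ^ (d - 2))⁻¹ * P)) +
            3 * (c⁻¹ * M * ((meshSize t ^ (d - 2))⁻¹ * P)) := by gcongr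
        _ = _ := by ring
    · push Not at hall
      obtain ⟨v, hv, hvj⟩ := hall
      refine ⟨v, hv, ?_⟩
      rw [cutProj_vertex hk hP hnode hu hij ht hv hvj, zero_pow two_ne_zero]
      positivity
  obtain ⟨v, hv, hvb⟩ := hvertex
  have hy' := hosc t ht i y hy v (subset_simplex t hv)
  have hy'' : (cutProj 𝒯 k Ω Ωs i u y - cutProj 𝒯 k Ω Ωs i u v) ^ 2 ≤
      C₁ * ((meshSize t ^ (d - 2))⁻¹ * P) := hy'.trans (by gcongr)
  have hsplit : cutProj 𝒯 k Ω Ωs i u y ^ 2 ≤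
      2 * (cutProj 𝒯 k Ω Ωs i u y - cutProj 𝒯 k Ω Ωs i u v) ^ 2 +
        2 * cutProj 𝒯 k Ω Ωs i u v ^ 2 := by
    nlinarith [sq_nonneg (cutProj 𝒯 k Ω Ωs i u y - 2 * cutProj 𝒯 k Ω Ωs i u v)]
  linarith

theorem exists_scaled_le_patchEnergy (hd : 2 ≤ d) (hk : 1 ≤ k) (hΩ : IsBoundedDomain Ω)
    {σ K r : ℝ} (hσ : 0 < σ) (hK : 0 < K) (hr : 0 < r) :
    ∃ C : ℝ, 0 < C ∧ ∀ Ωs : Fin 2 → Set (Space d), IsPartition Ω Ωs →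
      IsRegularHypersurface K r (interface Ωs) →
      ∀ 𝒯 : Geometry.SimplicialComplex ℝ (Space d), ∀ h𝒯 : IsTriangulation 𝒯 Ω,
      IsShapeRegular σ 𝒯 → (∀ a, IsNode 𝒯 k a → nodePos k a ∉ interface Ωs) →
      ∀ u ∈ cutSpace 𝒯 k Ω Ωs, ∀ t ∈ cutCells 𝒯 Ωs,
      (meshSize t ^ 2)⁻¹ * ∫ x in simplex t, u x ^ 2 ≤ C * patchEnergy h𝒯 k Ωs u t := by
  obtain ⟨C, hC, hle⟩ := exists_sq_cutProj_le hd hk hΩ hσ hK hr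
  have hω := ballVol_pos d
  refine ⟨4 * (ballVol d * C), by positivity, ?_⟩
  intro Ωs hP hreg 𝒯 h𝒯 hT hnode u hu t ht
  have hh := meshSize_pos (by omega) ht.1
  have h := hle Ωs hP hreg 𝒯 h𝒯 hT hnode u hu t ht
  obtain ⟨v₀, hv₀⟩ := 𝒯.nonempty_of_mem_faces ht.1.1
  have hP0 : 0 ≤ patchEnergy h𝒯 k Ωs u t := (localEnergy_nonneg u t).trans
    (localEnergy_le_patchEnergy (k := k) h𝒯 u ht ⟨v₀, hv₀, hv₀⟩)
  set P := patchEnergy h𝒯 k Ωs u t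
  have hsq : ∀ y ∈ simplex t, u y ^ 2 ≤ 4 * (C * ((meshSize t ^ (d - 2))⁻¹ * P)) := by
    intro y hy
    have h0 := h 0 1 (by decide) y hy
    have h1 := h 1 0 (by decide) y hy
    have hsum := congrFun (cutProj_add_cutProj hk hP hnode hu) y
    rw [Pi.add_apply] at hsum
    rw [← hsum]
    nlinarith [sq_nonneg (cutProj 𝒯 k Ω Ωs 0 u y - cutProj 𝒯 k Ω Ωs 1 u y)]
  calc (meshSize t ^ 2)⁻¹ * ∫ x in simplex t, u x ^ 2
      ≤ (meshSize t ^ 2)⁻¹ *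
        (ballVol d * (meshSize t ^ d * (4 * (C * ((meshSize t ^ (d - 2))⁻¹ * P))))) := by
        gcongr
        exact setIntegral_sq_le (by omega) ht.1 (by positivity) hsq
    _ = 4 * (ballVol d * C) * P := by
        obtain ⟨n, rfl⟩ := Nat.exists_eq_add_of_le' hd
        rw [Nat.add_sub_cancel, pow_add]
        field_simp

end

end CutFEM

end

/-! ### The norm equivalence -/

theorem mainTheorem5 (d : ℕ) (hd : d = 2 ∨ d = 3) (k : ℕ) (hk : 1 ≤ k)
    (Ω : Set (CutFEM.Space d)) (hΩ : CutFEM.IsBoundedDomain Ω)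
    (σ K r : ℝ) (hσ : 0 < σ) (hK : 0 < K) (hr : 0 < r) :
    ∃ c C : ℝ, 0 < c ∧ 0 < C ∧
      ∀ Ωs : Fin 2 → Set (CutFEM.Space d), CutFEM.IsPartition Ω Ωs →
      CutFEM.IsRegularHypersurface K r (CutFEM.interface Ωs) →
      ∀ 𝒯 : Geometry.SimplicialComplex ℝ (CutFEM.Space d),
      CutFEM.IsTriangulation 𝒯 Ω → CutFEM.IsShapeRegular σ 𝒯 →
      (∀ a, CutFEM.IsNode 𝒯 k a → CutFEM.nodePos k a ∉ CutFEM.interface Ωs) →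
      ∀ uΓ : CutFEM.cutSpace 𝒯 k Ω Ωs,
        c * CutFEM.scaledL2Norm 𝒯 Ωs uΓ ≤ CutFEM.bNorm 𝒯 k Ω Ωs (0, uΓ) ∧
        CutFEM.bNorm 𝒯 k Ω Ωs (0, uΓ) ≤ C * CutFEM.scaledL2Norm 𝒯 Ωs uΓ := by
  have hd2 : 2 ≤ d := by omega
  obtain ⟨C₁, hC₁, hupper⟩ := CutFEM.exists_localEnergy_le hd2 hk hΩ hσ hK hr
  obtain ⟨C₂, hC₂, hlower⟩ := CutFEM.exists_scaled_le_patchEnergy hd2 hk hΩ hσ hK hr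
  -- The factor (d + 1) σ ^ d bounds the overlap of the patches; the square roots arise because the
  -- local estimates are for squared norms.
  refine ⟨(Real.sqrt (C₂ * ((d + 1) * σ ^ d)))⁻¹, Real.sqrt C₁, by positivity, by positivity, ?_⟩
  intro Ωs hP hreg 𝒯 h𝒯 hT hnode u
  rw [CutFEM.bNorm_eq (by omega) hk hσ hT h𝒯, CutFEM.scaledL2Norm_eq h𝒯]
  constructor
  · rw [inv_mul_le_iff₀ (by positivity), ← Real.sqrt_mul (by positivity)]
    refine Real.sqrt_le_sqrt ?_
    calc _ ≤ ∑ t ∈ (CutFEM.finite_cutCells h𝒯 Ωs).toFinset,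
          C₂ * CutFEM.patchEnergy h𝒯 k Ωs u t :=
          Finset.sum_le_sum fun t ht => hlower Ωs hP hreg 𝒯 h𝒯 hT hnode u u.2 t
            ((Set.Finite.mem_toFinset _).1 ht)
      _ ≤ C₂ * ((d + 1) * σ ^ d * ∑ t ∈ (CutFEM.finite_cutCells h𝒯 Ωs).toFinset,
          CutFEM.localEnergy 𝒯 k Ω Ωs u t) := by
          rw [← Finset.mul_sum]
          gcongr
          exact CutFEM.sum_patchEnergy_le (by omega) hσ hT h𝒯 u
      _ = _ := by ring
  · rw [← Real.sqrt_mul hC₁.le, Finset.mul_sum]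
    refine Real.sqrt_le_sqrt (Finset.sum_le_sum fun t ht => ?_)
    exact hupper Ωs hP hreg 𝒯 hT u u.2 t ((Set.Finite.mem_toFinset _).1 ht)
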